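/- **Setting.** Let $q\ge 2$ be an integer and let $\mathbb T_q$ be the homogeneous tree of degree $q+1$ with a root at infinity $\omega_*$ (a boundary point of the tree). Let $d$ be the graph distance, $\ell(x)=\lim_j\,(j-d(x,x_j))$ the level function, where $(x_j)_{j\ge 0}$ is a geodesic ray ending at $\omega_*$, $\mathfrak p(x)$ the only neighbour of $x$ with $\ell(\mathfrak p(x))=\ell(x)+1$, and $m(x)=q^{\ell(x)}$ the canonical flow measure. Write $x\le y$ if $d(x,y)=\ell(y)-\ell(x)$. Let $\nabla f(x)=f(x)-f(\mathfrak p(x))$, let $\mathcal L=\frac12\nabla^*\nabla$ be the flow Laplacian on $L^2(m)$, and define $F(\mathcal L)$, for continuous $F:\mathbb R\to\mathbb C$, by the functional calculus of the bounded self-adjoint operator $\mathcal L$. The atomic Hardy space $H^1(m)$ consists of the sums $f=\sum_j c_ja_j$ with $\sum_j|c_j|<\infty$, where each $a_j$ is an atom: a function supported in a set $R=\{y: y\le x,\ h'\le d(x,y)<h''\}$, with $x\in\mathbb T_q$ and integers $h'\ge1$, $2\le h''/h'\le 12$, such that $\|a_j\|_\infty\le m(R)^{-1}$ and $\sum_y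 a_j(y)m(y)=0$; $\|f\|_{H^1}$ is the infimum of $\sum_j|c_j|$ over all such representations. For an operator $A$ bounded on $L^2(m)$, $\|A\|_{H^1\to L^1}\in[0,\infty]$ is the supremum of $\|Af\|_{L^1(m)}$ over $f\in L^2(m)\cap H^1(m)$ with $\|f\|_{H^1}\le 1$, and $\|A\|_{L^1\to L^1}$ is defined in the same way, with $L^1(m)$ in place of $H^1(m)$. For $s\ge 0$, $L^p_s(\mathbb R)$ denotes the $L^p$ Sobolev (Bessel potential) space of order $s$. **Proposition 6.11.** Let $\chi_0\in C_c^\infty(\mathbb R)$ be such that $\operatorname{supp}\chi_0\subseteq(-1/2,1/2)$ and $\chi_0=1$ on $[-1/4,1/4]$. For $t\in\mathbb R$ let $F_t(\lambda)=e^{it\lambda}\chi_0(\lambda)$. 1. For every $s\ge 0$ there is a constant $C>0$, depending only on $s$ and $\chi_0$, such that $\|F_t\|_{L^\infty_s}\le C(1+|t|)^s$ for all $t\in\mathbb R$. 2. There is $t_0>0$, depending only on $\chi_0$, such that for every integer $q\ge 2$ there is a constant $c>0$, depending only on $q$ and $\chi_0$, with $$\|F_t(\mathcal L)\|_{H^1(m)\to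 L^1(m)}\ge c\,t^{3/2}\qquad\text{for all } t\ge t_0,$$ where $\mathcal L$ is the flow Laplacian on $(\mathbb T_q,m)$. 3. Hence, on $(\mathbb T_q,m)$ with $q\ge2$, the multiplier estimates that hold for $s>3/2$ fail for every $0\le s<3/2$: there is no constant $C$ such that $$\|F(\mathcal L)\|_{L^1\to L^1}\le C\,\|F\|_{L^2_s}\qquad\text{for all }F\in C_c^\infty(\mathbb R),$$ and, for any $\chi\in C_c^\infty(\mathbb R)$ with $\operatorname{supp}\chi\subseteq(3/4,5/4)$, $0\le\chi\le1$ and $\chi(1)=1$, there is no constant $C$ such that $$\|F(\mathcal L)\|_{H^1\to L^1}\le C\sup_{0<r\le 2}\|F(r\,\cdot)\,\chi\|_{L^2_s}\qquad\text{for all }F\in C_c^\infty(\mathbb R).$$ -/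

import Mathlib

open MeasureTheory Filter Topology SchwartzMap
open scoped ENNReal NNReal ContDiff

noncomputable section

/-- A locally finite tree with a root at infinity. The root is the boundary point determined by a
geodesic ray, and the choice of the ray also fixes the normalization of the level function
(every level function of the rooted tree arises from a ray ending at the root). -/
structure InfinityRootedTree (V : Type*) where
  graph : SimpleGraph V
  isTree : graph.IsTree
  finite_neighborSet : ∀ x, (graph.neighborSet x).Finite
  ray : ℕ → V
  dist_ray : ∀ j k, graph.dist (ray j) (ray (j + k)) = k

namespace InfinityRootedTree

variable {V : Type*} (T : InfinityRootedTree V)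

/-- The level function `ℓ(x) = lim_j (j - d(x, x_j))`. -/
def level (x : V) : ℤ :=
  limUnder atTop (fun j : ℕ => (j : ℤ) - T.graph.dist x (T.ray j))

/-- `x ≤ y`: the vertex `y` lies above `x`, that is, `d(x, y) = ℓ(y) - ℓ(x)`. -/
def Below (x y : V) : Prop := (T.graph.dist x y : ℤ) = T.level y - T.level x

theorem eventually_level (x : V) :
    ∀ᶠ j : ℕ in atTop, (j : ℤ) - T.graph.dist x (T.ray j) = T.level x := by
  have hmono : Monotone (fun j : ℕ => (j : ℤ) - T.graph.dist x (T.ray j)) := by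
    refine monotone_nat_of_le_succ fun j => ?_
    have h1 := T.isTree.connected.dist_triangle (u := x) (v := T.ray j) (w := T.ray (j + 1))
    have h2 := T.dist_ray j 1
    push_cast
    omega
  have hbdd : BddAbove (Set.range (fun j : ℕ => (j : ℤ) - T.graph.dist x (T.ray j))) := by
    refine ⟨T.graph.dist (T.ray 0) x, ?_⟩
    rintro _ ⟨j, rfl⟩
    have h1 := T.isTree.connected.dist_triangle (u := T.ray 0) (v := x) (w := T.ray j)
    have h2 := T.dist_ray 0 j
    rw [zero_add] at h2
    dsimp only
    omega
  have h := tendsto_atTop_ciSup hmono hbdd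
  have h' : limUnder atTop (fun j : ℕ => (j : ℤ) - T.graph.dist x (T.ray j)) = _ := h.limUnder_eq
  rw [← h'] at h
  rw [nhds_discrete] at h
  exact tendsto_pure.1 h

/-- In a tree, a neighbour of `x` that is not farther from `v` than `x` is the second vertex of
the path from `x` to `v`. -/
theorem cons_eq {x y v : V} (h : T.graph.Adj x y)
    (hd : T.graph.dist y v ≤ T.graph.dist x v) (p : T.graph.Walk x v) (hp : p.IsPath) :
    p.snd = y ∧ p.length = T.graph.dist y v + 1 := by
  classical
  obtain ⟨w, hw, hl⟩ := T.isTree.connected.exists_path_of_dist y v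
  have hx : x ∉ w.support := by
    intro hx
    have h1 := SimpleGraph.dist_le (w.dropUntil x hx)
    have h2 : (w.takeUntil x hx).length + (w.dropUntil x hx).length = w.length := by
      rw [← SimpleGraph.Walk.length_append, SimpleGraph.Walk.take_spec]
    have h3 : (w.takeUntil x hx).length ≠ 0 := by
      intro h0
      exact h.ne (SimpleGraph.Walk.eq_of_length_eq_zero h0).symm
    omega
  have hc : (SimpleGraph.Walk.cons h w).IsPath := (SimpleGraph.Walk.cons_isPath_iff h w).2 ⟨hw, hx⟩
  have := (T.isTree.existsUnique_path x v).unique hp hc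
  subst this
  simp [hl]

theorem level_adj {x y : V} (h : T.graph.Adj x y) :
    T.level y = T.level x + 1 ∨ T.level x = T.level y + 1 := by
  obtain ⟨j, hx, hy⟩ := ((T.eventually_level x).and (T.eventually_level y)).exists
  obtain ⟨p, hp, hpl⟩ := T.isTree.connected.exists_path_of_dist x (T.ray j)
  obtain ⟨p', hp', hpl'⟩ := T.isTree.connected.exists_path_of_dist y (T.ray j)
  rcases le_total (T.graph.dist y (T.ray j)) (T.graph.dist x (T.ray j)) with hle | hle
  · have := (T.cons_eq h hle p hp).2
    left; omega
  · have := (T.cons_eq h.symm hle p' hp').2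
    right; omega

/-- Every vertex has exactly one neighbour lying above it. -/
theorem existsUnique_pred (x : V) :
    ∃! y, T.graph.Adj x y ∧ T.level y = T.level x + 1 := by
  obtain ⟨j, hx, hj⟩ := ((T.eventually_level x).and
    (eventually_gt_atTop (T.level x).toNat)).exists
  obtain ⟨p, hp, hpl⟩ := T.isTree.connected.exists_path_of_dist x (T.ray j)
  have hnil : ¬ p.Nil := by
    intro h
    have := SimpleGraph.Walk.length_eq_zero_iff.2 h
    omega
  refine ⟨p.snd, ⟨p.adj_snd hnil, ?_⟩, ?_⟩
  · obtain ⟨k, hk1, hk2, hjk⟩ := ((T.eventually_level x).and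
      ((T.eventually_level p.snd).and (eventually_ge_atTop j))).exists
    obtain ⟨i, rfl⟩ := Nat.exists_eq_add_of_le hjk
    have h1 := SimpleGraph.dist_le p.tail
    have h2 := p.length_tail_add_one hnil
    have h3 := T.isTree.connected.dist_triangle (u := p.snd) (v := T.ray j) (w := T.ray (j + i))
    have h4 := T.dist_ray j i
    have h5 := T.level_adj (p.adj_snd hnil)
    push_cast at hk1 hk2
    omega
  · rintro y ⟨hy, hl⟩
    obtain ⟨k, hk1, hk2, hk3, hk4⟩ := ((T.eventually_level x).and ((T.eventually_level y).and
      ((T.eventually_level p.snd).and (eventually_ge_atTop j)))).exists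
    obtain ⟨i, rfl⟩ := Nat.exists_eq_add_of_le hk4
    obtain ⟨r, hr, hrl⟩ := T.isTree.connected.exists_path_of_dist x (T.ray (j + i))
    have h1 := SimpleGraph.dist_le p.tail
    have h2 := p.length_tail_add_one hnil
    have h3 := T.isTree.connected.dist_triangle (u := p.snd) (v := T.ray j) (w := T.ray (j + i))
    have h4 := T.dist_ray j i
    push_cast at hk1 hk2 hk3
    have e1 := (T.cons_eq hy (by omega) r hr).1
    have e2 := (T.cons_eq (p.adj_snd hnil) (by omega) r hr).1
    exact e1.symm.trans e2

/-- The predecessor of `x`, the only neighbour of `x` lying above `x`. -/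
def pred (x : V) : V := (T.existsUnique_pred x).choose

theorem pred_spec (x : V) : T.graph.Adj x (T.pred x) ∧ T.level (T.pred x) = T.level x + 1 :=
  (T.existsUnique_pred x).choose_spec.1

/-- The successors of `x`: all neighbours of `x` except the predecessor. -/
def succ (x : V) : Set V := {y | T.graph.Adj x y ∧ y ≠ T.pred x}

theorem mem_succ_iff (x y : V) : y ∈ T.succ x ↔ T.pred y = x := by
  constructor
  · rintro ⟨h, hne⟩
    rcases T.level_adj h with hl | hl
    · exact absurd ((T.existsUnique_pred x).unique ⟨h, hl⟩ (T.pred_spec x)) hne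
    · exact (T.existsUnique_pred y).unique (T.pred_spec y) ⟨h.symm, hl⟩
  · rintro rfl
    obtain ⟨h, hl⟩ := T.pred_spec y
    refine ⟨h.symm, fun he => ?_⟩
    have := (T.pred_spec (T.pred y)).2
    rw [← he] at this
    omega

end InfinityRootedTree

/-- A flow tree: a tree with root at infinity together with a flow measure, that is, a function
`m : V → (0, ∞)` with `m(x) = ∑_{y ∈ succ(x)} m(y)`. -/
structure FlowTree (V : Type*) extends InfinityRootedTree V where
  m : V → ℝ
  m_pos : ∀ x, 0 < m x
  m_flow : ∀ x, m x = ∑ᶠ y ∈ toInfinityRootedTree.succ x, m y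

namespace FlowTree

variable {V : Type*}

/-- The flow tree is the homogeneous tree of degree `q + 1` (every vertex has `q` successors) with
the canonical flow measure `q ^ ℓ(x)`. -/
def IsCanonical (T : FlowTree V) (q : ℕ) : Prop :=
  (∀ x, (T.succ x).ncard = q) ∧ ∀ x, T.m x = (q : ℝ) ^ T.level x

variable [MeasurableSpace V]

/-- The discrete measure on the vertices with density `m` with respect to counting measure. -/
def measure (T : FlowTree V) : Measure V :=
  Measure.sum fun x => ENNReal.ofReal (T.m x) • Measure.dirac x

variable [DiscreteMeasurableSpace V]

theorem measure_apply (T : FlowTree V) (S : Set V) :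
    T.measure S = ∑' x, S.indicator (fun x => ENNReal.ofReal (T.m x)) x := by
  rw [measure, Measure.sum_apply _ (MeasurableSet.of_discrete)]
  refine tsum_congr fun x => ?_
  by_cases hx : x ∈ S <;> simp [Measure.dirac_apply' _ (MeasurableSet.of_discrete (s := S)), hx]

theorem measurePreserving_pred (T : FlowTree V) :
    MeasurePreserving T.pred T.measure T.measure := by
  refine ⟨Measurable.of_discrete, ?_⟩
  ext S hS
  rw [Measure.map_apply Measurable.of_discrete hS, measure_apply, measure_apply,
    ← ENNReal.tsum_fiberwise _ T.pred]
  refine tsum_congr fun x => ?_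
  have hset : T.pred ⁻¹' {x} = T.succ x := by
    ext y
    simp [T.mem_succ_iff]
  have hfin : (T.succ x).Finite := (T.finite_neighborSet x).subset fun y hy => hy.1
  have hsum : ENNReal.ofReal (T.m x) = ∑' y : T.succ x, ENNReal.ofReal (T.m y) := by
    have := hfin.fintype
    rw [T.m_flow x, finsum_mem_eq_sum_of_inter_support_eq (t := (T.succ x).toFinset) _ (by simp),
      ENNReal.ofReal_sum_of_nonneg fun y _ => (T.m_pos y).le, tsum_fintype]
    exact (Finset.sum_set_coe (T.succ x)
      (f := fun y => ENNReal.ofReal (T.m y))).symm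
  rw [hset]
  by_cases hx : x ∈ S
  · rw [Set.indicator_of_mem hx, hsum]
    refine tsum_congr fun y => ?_
    rw [Set.indicator_of_mem]
    rw [Set.mem_preimage, (T.mem_succ_iff x y).1 y.2]
    exact hx
  · rw [Set.indicator_of_notMem hx]
    refine ENNReal.tsum_eq_zero.2 fun y => ?_
    rw [Set.indicator_of_notMem]
    rw [Set.mem_preimage, (T.mem_succ_iff x y).1 y.2]
    exact hx

/-- The shift operator `Σ f(x) = f(p(x))` on `L²(m)`. -/
def shift (T : FlowTree V) : Lp ℂ 2 T.measure →L[ℂ] Lp ℂ 2 T.measure :=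
  (Lp.compMeasurePreservingₗᵢ ℂ T.pred T.measurePreserving_pred).toContinuousLinearMap

/-- The flow gradient `∇ = I - Σ` on `L²(m)`. -/
def gradient (T : FlowTree V) : Lp ℂ 2 T.measure →L[ℂ] Lp ℂ 2 T.measure :=
  ContinuousLinearMap.id ℂ _ - T.shift

/-- The flow Laplacian `𝓛 = (1/2) ∇* ∇` on `L²(m)`. -/
def laplacian (T : FlowTree V) : Lp ℂ 2 T.measure →L[ℂ] Lp ℂ 2 T.measure :=
  (1 / 2 : ℂ) • (ContinuousLinearMap.adjoint T.gradient ∘L T.gradient)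

/-- The operator `F(𝓛)` on `L²(m)`, for continuous `F : ℝ → ℂ`, through the continuous functional
calculus of the bounded self-adjoint operator `𝓛` (whose spectrum is real). -/
def multiplier (T : FlowTree V) (F : ℝ → ℂ) : Lp ℂ 2 T.measure →L[ℂ] Lp ℂ 2 T.measure :=
  cfc (fun z : ℂ => F z.re) T.laplacian

/-- The trapezoid `{y : y ≤ x, h' ≤ d(x, y) < h''}`. -/
def trapezoid (T : FlowTree V) (x : V) (h' h'' : ℕ) : Set V :=
  {y | T.Below y x ∧ h' ≤ T.graph.dist x y ∧ T.graph.dist x y < h''}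

/-- A `(1, ∞)`-atom: a function `a` supported in an admissible trapezoid `R`
(`h' ≥ 1` and `2 ≤ h''/h' ≤ 12`), with `‖a‖_∞ ≤ 1 / m(R)` and vanishing integral.
(Singletons carry only the zero atom.) -/
def IsAtom (T : FlowTree V) (a : V → ℂ) : Prop :=
  ∃ (x : V) (h' h'' : ℕ), 1 ≤ h' ∧ 2 * h' ≤ h'' ∧ h'' ≤ 12 * h' ∧
    Function.support a ⊆ T.trapezoid x h' h'' ∧
    (∀ y, ‖a y‖ₑ ≤ (T.measure (T.trapezoid x h' h''))⁻¹) ∧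
    ∫ y, a y ∂T.measure = 0

/-- The norm of the atomic Hardy space `H¹(m)`: the infimum of `∑ |c_j|` over all representations
`f = ∑ c_j a_j` with atoms `a_j`; it is `∞` when `f` is not in `H¹(m)`. (An atomic series with
`∑ |c_j| < ∞` converges absolutely in `L¹(m)`, hence also pointwise, to the same sum.) -/
def hardyNorm (T : FlowTree V) (f : V → ℂ) : ℝ≥0∞ :=
  ⨅ (c : ℕ → ℂ) (a : ℕ → V → ℂ) (_ : ∀ j, T.IsAtom (a j))
    (_ : ∀ x, HasSum (fun j => c j * a j x) (f x)), ∑' j, ‖c j‖ₑ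

/-- The norm `‖A‖_{H¹(m) → L¹(m)}`, possibly infinite, of an operator `A` given on `L²(m)`: the
supremum of `‖A f‖₁` over all `f` in `L²(m) ∩ H¹(m)` with `‖f‖_{H¹} ≤ 1`. -/
def hardyOpNorm (T : FlowTree V) (A : Lp ℂ 2 T.measure →L[ℂ] Lp ℂ 2 T.measure) : ℝ≥0∞ :=
  ⨆ (f : Lp ℂ 2 T.measure) (_ : T.hardyNorm f ≤ 1), eLpNorm (A f) 1 T.measure

/-- The norm `‖A‖_{L¹(m) → L¹(m)}`, possibly infinite, of an operator `A` given on `L²(m)`: the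
supremum of `‖A f‖₁` over all `f` in `L²(m) ∩ L¹(m)` with `‖f‖₁ ≤ 1`. -/
def lOneOpNorm (T : FlowTree V) (A : Lp ℂ 2 T.measure →L[ℂ] Lp ℂ 2 T.measure) : ℝ≥0∞ :=
  ⨆ (f : Lp ℂ 2 T.measure) (_ : eLpNorm f 1 T.measure ≤ 1), eLpNorm (A f) 1 T.measure

end FlowTree

/-- The norm of `f` in the inhomogeneous Sobolev (Bessel potential) space `L^p_s(ℝ)`, of order
`s ≥ 0`: the `L^p` norm of the Bessel potential of order `s` of `f`, when `f` is in `L^p` and that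
tempered distribution is an `L^p` function, and `∞` otherwise. -/
def sobolevNorm (p : ℝ≥0∞) [Fact (1 ≤ p)] (s : ℝ) (f : ℝ → ℂ) : ℝ≥0∞ :=
  ⨅ (hf : MemLp f p volume) (g : Lp ℂ p (volume : Measure ℝ))
    (_ : TemperedDistribution.besselPotential ℝ ℂ s
        (Lp.toTemperedDistribution (hf.toLp f)) = Lp.toTemperedDistribution g), ‖g‖ₑ

/-- The truncated Schrödinger multiplier `F_t(λ) = e^{itλ} χ₀(λ)`. -/
def schrodinger (χ₀ : ℝ → ℂ) (t : ℝ) (x : ℝ) : ℂ :=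
  Complex.exp (Complex.I * t * x) * χ₀ x

end

/-! The lower bound comes from testing on one fixed atom, a multiple of `δ_x - δ_{p(x)}` with unit
point masses, and from an exact formula for the kernel of `F(𝓛)`.

Since `Σ*Σ = 1`, one has `2(1 - 𝓛) = Σ + Σ*`, and the Chebyshev polynomial `U_k` of `1 - 𝓛` is the
sum of the words `Σ^a (Σ*)^b` with `a + b = k`. Such words have explicit kernels. If the ascending
paths from `y` and `x` first meet after `i` and `j` steps, the kernel of `F(𝓛)` at `(y, x)` is
`m(p^j x)⁻¹ ∑_l q^{-l} s(i + j + 1 + 2l)`, where `s(n)` are the sine coefficients of `F(1 - cos θ)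
sin θ` (`inner_multiplier_pointMass`). Replacing `x` by `p(x)` keeps the meeting vertex and lowers
the index by one, so on the atom only the differences `d(n) = s(n + 1) - s(n)` occur. The vertices
`y` with prescribed meeting steps have mass comparable to that of the meeting vertex, which cancels
the weight. The geometric sum is inverted at the cost of a factor 2, and there are at least `N`
meeting pairs for each large index. Hence the `L¹` norm is at least a constant times `N ∑_{n ≥ N +
2} |d(n)|` (`le_eLpNorm_multiplier_sub`).

For `F_t`, Parseval gives `∑ |d(n)|² = Q` independent of `t`, because the modulation is unimodular,
and van der Corput's lemma gives `|d(n)| ≤ C t^{-1/2}`. The first `κt` terms therefore carry at most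
half of `Q`, and dividing the remaining `ℓ²` mass by the supremum yields an `ℓ¹` tail of size `√t`
beyond `N ~ t` (`exists_le_tsum_sineDiff_schrodinger`). The product of `N` and the tail is of order
`t^{3/2}`.

The Sobolev bounds hold because modulation translates the Fourier transform by `t / 2π`, which costs
`(1 + |t|)^s` in the weight. Comparing the two growth rates excludes every `s < 3/2`. -/

noncomputable section

/-! ### Sobolev norms of modulated test functions -/

section SobolevBounds

open FourierTransform

/-- On Schwartz functions the distributional Bessel potential is the Schwartz Fourier multiplier,
which supplies a competitor for the infimum defining `sobolevNorm`. -/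
theorem sobolevNorm_schwartz_le (p : ℝ≥0∞) [Fact (1 ≤ p)] (s : ℝ) (f : 𝓢(ℝ, ℂ)) :
    sobolevNorm p s f ≤ ‖(SchwartzMap.fourierMultiplierCLM ℂ
      (fun x : ℝ ↦ ((1 + ‖x‖ ^ 2) ^ (s / 2) : ℝ)) f).toLp p (volume : Measure ℝ)‖ₑ := by
  suffices h : TemperedDistribution.besselPotential ℝ ℂ s
      (Lp.toTemperedDistribution ((f.memLp p volume).toLp f)) =
      Lp.toTemperedDistribution ((SchwartzMap.fourierMultiplierCLM ℂ
        (fun x : ℝ ↦ ((1 + ‖x‖ ^ 2) ^ (s / 2) : ℝ)) f).toLp p (volume : Measure ℝ)) by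
    exact iInf_le_of_le (f.memLp p volume) (iInf_le_of_le _ (iInf_le_of_le h le_rfl))
  have e : (f.memLp p volume).toLp f = f.toLp p (volume : Measure ℝ) := rfl
  rw [e, TemperedDistribution.besselPotential, Lp.toTemperedDistribution_toLp_eq,
    TemperedDistribution.fourierMultiplierCLM_toTemperedDistributionCLM_eq (by fun_prop),
    Lp.toTemperedDistribution_toLp_eq]
  congr 1
  exact SchwartzMap.fourierMultiplierCLM_ofReal ℂ
    (Function.hasTemperateGrowth_one_add_norm_sq_rpow ℝ (s / 2)) f

theorem norm_fourierInv_toLp_top_le (f : 𝓢(ℝ, ℂ)) :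
    ‖(𝓕⁻ f).toLp ⊤ (volume : Measure ℝ)‖ ≤ ‖f.toLp 1 (volume : Measure ℝ)‖ := by
  refine norm_toLp_top_le.trans (seminorm_le_bound ℝ 0 0 _ (by positivity) fun x => ?_)
  have : 𝓕⁻ f x = 𝓕 f (-x) := by
    rw [SchwartzMap.fourierInv_coe, SchwartzMap.fourier_coe,
      Real.fourierInv_eq_fourier_neg]
  simpa [this] using norm_fourier_apply_le_toLp_one f (-x)

theorem norm_fourierInv_toLp_two (f : 𝓢(ℝ, ℂ)) :
    ‖(𝓕⁻ f).toLp 2 (volume : Measure ℝ)‖ = ‖f.toLp 2 (volume : Measure ℝ)‖ := by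
  rw [← norm_fourier_toL2_eq (𝓕⁻ f)]
  simp

/-- The Sobolev norms of order `s` in `L²` and `L^∞` are controlled by norms of the weighted
Fourier transform. -/
theorem sobolevNorm_le_eLpNorm_fourier (s : ℝ) (f : 𝓢(ℝ, ℂ)) :
    sobolevNorm ⊤ s f ≤ eLpNorm (fun ξ : ℝ => (1 + ‖ξ‖ ^ 2) ^ (s / 2) • 𝓕 f ξ) 1 volume ∧
    sobolevNorm 2 s f ≤ eLpNorm (fun ξ : ℝ => (1 + ‖ξ‖ ^ 2) ^ (s / 2) • 𝓕 f ξ) 2 volume := by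
  have key : ∀ p : ℝ≥0∞, eLpNorm (fun ξ : ℝ => (1 + ‖ξ‖ ^ 2) ^ (s / 2) • 𝓕 f ξ) p volume =
      ‖(SchwartzMap.smulLeftCLM ℂ (fun x : ℝ ↦ ((1 + ‖x‖ ^ 2) ^ (s / 2) : ℝ))
        (𝓕 f)).toLp p (volume : Measure ℝ)‖ₑ := by
    intro p
    rw [Lp.enorm_def, eLpNorm_congr_ae (coeFn_toLp _ p volume)]
    congr 1
    ext ξ
    rw [SchwartzMap.smulLeftCLM_apply_apply
      (Function.hasTemperateGrowth_one_add_norm_sq_rpow ℝ (s / 2))]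
  refine ⟨(sobolevNorm_schwartz_le _ s f).trans ?_, (sobolevNorm_schwartz_le _ s f).trans ?_⟩
  · rw [key, SchwartzMap.fourierMultiplierCLM_apply, enorm_le_iff_norm_le]
    exact norm_fourierInv_toLp_top_le _
  · rw [key, SchwartzMap.fourierMultiplierCLM_apply, enorm_le_iff_norm_le]
    exact (norm_fourierInv_toLp_two _).le

/-- Peetre's inequality: `1 + |ξ| ≤ (1 + |a|)(1 + |ξ - a|)`, combined with `1 + ξ² ≤ (1 + |ξ|)²`. -/
theorem bessel_weight_le {s : ℝ} (hs : 0 ≤ s) (a ξ : ℝ) :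
    (1 + ‖ξ‖ ^ 2) ^ (s / 2) ≤ (1 + |a|) ^ s * (1 + |ξ - a|) ^ s := by
  rw [← Real.mul_rpow (by positivity) (by positivity)]
  have h1 : (1 + ‖ξ‖ ^ 2) ≤ ((1 + |a|) * (1 + |ξ - a|)) ^ (2 : ℝ) := by
    rw [Real.rpow_two, Real.norm_eq_abs]
    have h : |ξ| ≤ |a| + |ξ - a| := by
      have := abs_add_le a (ξ - a)
      rwa [add_sub_cancel] at this
    have h2 : 1 + |ξ| ≤ (1 + |a|) * (1 + |ξ - a|) := by
      nlinarith [abs_nonneg a, abs_nonneg (ξ - a)]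
    nlinarith [abs_nonneg ξ]
  calc (1 + ‖ξ‖ ^ 2) ^ (s / 2)
      ≤ (((1 + |a|) * (1 + |ξ - a|)) ^ (2 : ℝ)) ^ (s / 2) :=
        Real.rpow_le_rpow (by positivity) h1 (by positivity)
    _ = _ := by
        rw [← Real.rpow_mul (by positivity)]
        congr 1
        ring

/-- The weight `(1 + |x|)^{-2}`. -/
def decayWeight (x : ℝ) : ℝ := (1 + ‖x‖) ^ (-2 : ℝ)

theorem decayWeight_nonneg (x : ℝ) : 0 ≤ decayWeight x := by
  unfold decayWeight; positivity

theorem decayWeight_le_one (x : ℝ) : decayWeight x ≤ 1 :=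
  Real.rpow_le_one_of_one_le_of_nonpos (by simp) (by norm_num)

theorem memLp_one_decayWeight : MemLp decayWeight 1 volume :=
  memLp_one_iff_integrable.2 (integrable_one_add_norm (by norm_num [Module.finrank_self]))

theorem memLp_two_decayWeight : MemLp decayWeight 2 volume := by
  refine (memLp_two_iff_integrable_sq memLp_one_decayWeight.1).2 ?_
  refine (memLp_one_iff_integrable.1 memLp_one_decayWeight).mono'
    (memLp_one_decayWeight.1.pow 2) (Eventually.of_forall fun x => ?_)
  rw [Real.norm_eq_abs, abs_of_nonneg (by positivity), sq]
  exact mul_le_of_le_one_left (decayWeight_nonneg x) (decayWeight_le_one x)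

/-- A constant bounding the norms of `decayWeight` in `L¹` and `L²`. -/
def decayConst : ℝ := 1 + max (eLpNorm decayWeight 1 volume).toReal
  (eLpNorm decayWeight 2 volume).toReal

theorem decayConst_pos : 0 < decayConst := by
  unfold decayConst
  have : 0 ≤ (eLpNorm decayWeight 1 volume).toReal := ENNReal.toReal_nonneg
  have := le_max_left (eLpNorm decayWeight 1 volume).toReal
    (eLpNorm decayWeight 2 volume).toReal
  linarith

theorem eLpNorm_decayWeight_le (p : ℝ≥0∞) (hp : p = 1 ∨ p = 2) :
    eLpNorm decayWeight p volume ≤ ENNReal.ofReal decayConst := by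
  rcases hp with rfl | rfl
  · refine ENNReal.le_ofReal_iff_toReal_le memLp_one_decayWeight.2.ne decayConst_pos.le |>.2 ?_
    have := le_max_left (eLpNorm decayWeight 1 volume).toReal
      (eLpNorm decayWeight 2 volume).toReal
    unfold decayConst; linarith
  · refine ENNReal.le_ofReal_iff_toReal_le memLp_two_decayWeight.2.ne decayConst_pos.le |>.2 ?_
    have := le_max_right (eLpNorm decayWeight 1 volume).toReal
      (eLpNorm decayWeight 2 volume).toReal
    unfold decayConst; linarith

/-- If the Fourier transform of `f` is concentrated near `a`, then the Sobolev norms of `f` of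
order `s` grow at most like `(1 + |a|)^s`. -/
theorem sobolevNorm_le_of_fourier_decay {s : ℝ} (hs : 0 ≤ s) (f : 𝓢(ℝ, ℂ)) {a A : ℝ} (hA : 0 ≤ A)
    (h : ∀ ξ : ℝ, ‖𝓕 f ξ‖ * (1 + |ξ - a|) ^ (s + 2) ≤ A) :
    sobolevNorm ⊤ s f ≤ ENNReal.ofReal (A * decayConst * (1 + |a|) ^ s) ∧
    sobolevNorm 2 s f ≤ ENNReal.ofReal (A * decayConst * (1 + |a|) ^ s) := by
  have key : ∀ p : ℝ≥0∞, (p = 1 ∨ p = 2) →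
      eLpNorm (fun ξ : ℝ => (1 + ‖ξ‖ ^ 2) ^ (s / 2) • 𝓕 f ξ) p volume ≤
        ENNReal.ofReal (A * decayConst * (1 + |a|) ^ s) := by
    intro p hp
    have hpt : ∀ ξ : ℝ, ‖(1 + ‖ξ‖ ^ 2) ^ (s / 2) • 𝓕 f ξ‖ ≤
        (A * (1 + |a|) ^ s) * decayWeight (ξ - a) := by
      intro ξ
      have h0 : 0 < 1 + |ξ - a| := by positivity
      have hw := bessel_weight_le hs a ξ
      -- The exponent `s + 2` splits into `s`, absorbed by the Bessel weight, and `2`, which leaves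
      -- a function in `L¹ ∩ L²`.
      have hd : decayWeight (ξ - a) * (1 + |ξ - a|) ^ (s + 2) = (1 + |ξ - a|) ^ s := by
        unfold decayWeight
        rw [Real.norm_eq_abs, ← Real.rpow_add h0]
        congr 1; ring
      rw [norm_smul, Real.norm_of_nonneg (by positivity)]
      calc (1 + ‖ξ‖ ^ 2) ^ (s / 2) * ‖𝓕 f ξ‖
          ≤ ((1 + |a|) ^ s * (1 + |ξ - a|) ^ s) * ‖𝓕 f ξ‖ := by gcongr
        _ = (1 + |a|) ^ s * decayWeight (ξ - a) * (‖𝓕 f ξ‖ * (1 + |ξ - a|) ^ (s + 2)) := by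
            rw [← hd]; ring
        _ ≤ (1 + |a|) ^ s * decayWeight (ξ - a) * A := by
            have := decayWeight_nonneg (ξ - a)
            gcongr
            exact h ξ
        _ = _ := by ring
    have hmp : MeasurePreserving (fun ξ : ℝ => ξ - a) volume volume :=
      measurePreserving_sub_right volume a
    calc _ ≤ eLpNorm (fun ξ : ℝ => (A * (1 + |a|) ^ s) • decayWeight (ξ - a)) p volume :=
          eLpNorm_mono_real hpt
      _ = ‖A * (1 + |a|) ^ s‖ₑ * eLpNorm (decayWeight ∘ fun ξ : ℝ => ξ - a) p volume :=
          eLpNorm_const_smul (A * (1 + |a|) ^ s) (decayWeight ∘ fun ξ : ℝ => ξ - a) p volume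
      _ = ‖A * (1 + |a|) ^ s‖ₑ * eLpNorm decayWeight p volume := by
          rw [eLpNorm_comp_measurePreserving memLp_one_decayWeight.1 hmp]
      _ ≤ ENNReal.ofReal (A * (1 + |a|) ^ s) * ENNReal.ofReal decayConst := by
          rw [Real.enorm_of_nonneg (by positivity)]
          gcongr
          exact eLpNorm_decayWeight_le p hp
      _ = _ := by
          rw [← ENNReal.ofReal_mul (by positivity)]
          congr 1; ring
  have h2 := sobolevNorm_le_eLpNorm_fourier s f
  exact ⟨h2.1.trans (key 1 (Or.inl rfl)), h2.2.trans (key 2 (Or.inr rfl))⟩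

theorem integral_norm_le_of_support {g : ℝ → ℂ} {D : ℝ} (hD : ∀ x, ‖g x‖ ≤ D)
    (hsupp : Function.support g ⊆ Set.Icc (-2) 2) : ∫ x, ‖g x‖ ≤ 4 * D := by
  have h1 : ∫ x, ‖g x‖ = ∫ x in Set.Icc (-2 : ℝ) 2, ‖g x‖ := by
    rw [setIntegral_eq_integral_of_forall_compl_eq_zero]
    intro x hx
    rw [norm_eq_zero]
    by_contra h
    exact hx (hsupp h)
  rw [h1]
  have h2 := norm_setIntegral_le_of_norm_le_const (μ := volume) (s := Set.Icc (-2 : ℝ) 2)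
    (f := fun x => ‖g x‖) (C := D) (by simp) (fun x _ => by simpa using hD x)
  have h3 : (volume : Measure ℝ).real (Set.Icc (-2) 2) = 4 := by
    rw [Measure.real, Real.volume_Icc]; norm_num
  rw [h3] at h2
  linarith [Real.le_norm_self (∫ x in Set.Icc (-2 : ℝ) 2, ‖g x‖)]

/-- Decay of the Fourier transform of a test function supported in `[-2, 2]`, in terms of uniform
bounds for the function and one of its derivatives. -/
theorem fourier_decay_of_bounds {g : ℝ → ℂ} (hg : ContDiff ℝ ∞ g) (hsupp : tsupport g ⊆ Set.Icc (-2) 2)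
    (N : ℕ) {D : ℝ} (h0 : ∀ x, ‖g x‖ ≤ D) (hN : ∀ x, ‖iteratedDeriv N g x‖ ≤ D) (ξ : ℝ) :
    ‖𝓕 g ξ‖ * (1 + |ξ|) ^ N ≤ 2 ^ N * (8 * D) := by
  have hc : HasCompactSupport g := HasCompactSupport.of_support_subset_isCompact isCompact_Icc
    ((subset_tsupport g).trans hsupp)
  have hD : 0 ≤ D := (norm_nonneg _).trans (h0 0)
  have hsuppN : ∀ n : ℕ, Function.support (iteratedDeriv n g) ⊆ tsupport g := by
    intro n x hx
    by_contra h
    apply hx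
    have h3 := support_iteratedFDeriv_subset (𝕜 := ℝ) (f := g) n
    have h4 : iteratedFDeriv ℝ n g x = 0 := by
      by_contra h5
      exact h (h3 h5)
    simp [iteratedDeriv, h4]
  have hcont : ∀ n : ℕ, Continuous (iteratedDeriv n g) := fun n =>
    hg.continuous_iteratedDeriv n (by exact_mod_cast le_top)
  have hint : ∀ n : ℕ, Integrable (iteratedDeriv n g) := fun n =>
    (hcont n).integrable_of_hasCompactSupport
      (HasCompactSupport.of_support_subset_isCompact hc ((hsuppN n)))
  have hF : ∀ (u : ℝ → ℂ), (∀ x, ‖u x‖ ≤ D) → Function.support u ⊆ Set.Icc (-2) 2 →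
      ‖𝓕 u ξ‖ ≤ 4 * D := by
    intro u hu hs
    refine le_trans ?_ (integral_norm_le_of_support hu hs)
    rw [Real.fourier_eq]
    refine (norm_integral_le_integral_norm _).trans (le_of_eq ?_)
    simp
  have e1 := hF g h0 ((subset_tsupport g).trans hsupp)
  have e2 := hF _ hN ((hsuppN N).trans hsupp)
  have e3 := congrFun (Real.fourier_iteratedDeriv (f := g) (N := ⊤) (n := N) hg
    (fun n _ => hint n) (by simp)) ξ
  have e4 : |ξ| ^ N * ‖𝓕 g ξ‖ ≤ 4 * D := by
    rw [e3, norm_smul, norm_pow] at e2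
    refine le_trans ?_ e2
    gcongr
    simp only [norm_mul, Complex.norm_real, Complex.norm_I, Real.norm_eq_abs, mul_one,
      Complex.norm_ofNat]
    have : 1 ≤ 2 * |Real.pi| := by
      rw [abs_of_pos Real.pi_pos]; linarith [Real.pi_gt_three]
    nlinarith [abs_nonneg ξ]
  -- The bounds by `4 * D` for `𝓕 g ξ` and for `|ξ| ^ N * 𝓕 g ξ` add up to `8 * D`; passing from `1
  -- + |ξ| ^ N` to `(1 + |ξ|) ^ N` costs `2 ^ N`.
  have e5 : (1 + |ξ|) ^ N ≤ 2 ^ N * (1 + |ξ| ^ N) := by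
    have h := add_pow_le (zero_le_one (α := ℝ)) (abs_nonneg ξ) N
    rw [one_pow] at h
    refine h.trans ?_
    gcongr
    · norm_num
    · omega
  calc ‖𝓕 g ξ‖ * (1 + |ξ|) ^ N ≤ ‖𝓕 g ξ‖ * (2 ^ N * (1 + |ξ| ^ N)) := by gcongr
    _ = 2 ^ N * (‖𝓕 g ξ‖ + |ξ| ^ N * ‖𝓕 g ξ‖) := by ring
    _ ≤ 2 ^ N * (8 * D) := by gcongr; linarith

theorem fourier_modulation (g : ℝ → ℂ) (a ξ : ℝ) :
    𝓕 (fun x : ℝ => Complex.exp (Complex.I * (2 * Real.pi * a : ℝ) * x) * g x) ξ =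
      𝓕 g (ξ - a) := by
  rw [Real.fourier_real_eq_integral_exp_smul, Real.fourier_real_eq_integral_exp_smul]
  congr 1
  ext x
  rw [smul_eq_mul, smul_eq_mul, ← mul_assoc, ← Complex.exp_add]
  congr 2
  push_cast
  ring

/-- Sobolev bounds for a modulated test function supported in `[-2, 2]`. -/
theorem sobolevNorm_modulation_le {s : ℝ} (hs : 0 ≤ s) {g : ℝ → ℂ} (hg : ContDiff ℝ ∞ g)
    (hsupp : tsupport g ⊆ Set.Icc (-2) 2) {D : ℝ} (h0 : ∀ x, ‖g x‖ ≤ D)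
    (hN : ∀ x, ‖iteratedDeriv ⌈s + 2⌉₊ g x‖ ≤ D) (t : ℝ) :
    sobolevNorm ⊤ s (fun x : ℝ => Complex.exp (Complex.I * t * x) * g x) ≤
        ENNReal.ofReal (2 ^ ⌈s + 2⌉₊ * (8 * D) * decayConst * (1 + |t|) ^ s) ∧
    sobolevNorm 2 s (fun x : ℝ => Complex.exp (Complex.I * t * x) * g x) ≤
        ENNReal.ofReal (2 ^ ⌈s + 2⌉₊ * (8 * D) * decayConst * (1 + |t|) ^ s) := by
  set a : ℝ := t / (2 * Real.pi) with ha
  have hta : t = 2 * Real.pi * a := by rw [ha]; field_simp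
  have hc : HasCompactSupport g := HasCompactSupport.of_support_subset_isCompact isCompact_Icc
    ((subset_tsupport g).trans hsupp)
  have hD : 0 ≤ D := (norm_nonneg _).trans (h0 0)
  have hsm : ContDiff ℝ ∞ (fun x : ℝ => Complex.exp (Complex.I * t * x) * g x) := by
    refine ContDiff.mul ?_ hg
    exact (contDiff_const.mul Complex.ofRealCLM.contDiff).cexp
  let f : 𝓢(ℝ, ℂ) := (hc.mul_left (f := fun x : ℝ => Complex.exp (Complex.I * t * x))).toSchwartzMap
    hsm
  have hf : (f : ℝ → ℂ) = fun x : ℝ => Complex.exp (Complex.I * t * x) * g x := rfl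
  have hdec : ∀ ξ : ℝ, ‖𝓕 f ξ‖ * (1 + |ξ - a|) ^ (s + 2) ≤ 2 ^ ⌈s + 2⌉₊ * (8 * D) := by
    intro ξ
    rw [SchwartzMap.fourier_coe, hf, hta, fourier_modulation]
    refine le_trans ?_ (fourier_decay_of_bounds hg hsupp _ h0 hN (ξ - a))
    gcongr
    rw [← Real.rpow_natCast]
    exact Real.rpow_le_rpow_of_exponent_le (by simp) (Nat.le_ceil _)
  have hle : |a| ≤ |t| := by
    rw [ha, abs_div]
    refine div_le_self (abs_nonneg t) ?_
    rw [abs_of_pos (by positivity)]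
    linarith [Real.pi_gt_three]
  have hmono : ENNReal.ofReal (2 ^ ⌈s + 2⌉₊ * (8 * D) * decayConst * (1 + |a|) ^ s) ≤
      ENNReal.ofReal (2 ^ ⌈s + 2⌉₊ * (8 * D) * decayConst * (1 + |t|) ^ s) := by
    have := decayConst_pos
    gcongr
  have := sobolevNorm_le_of_fourier_decay hs f (by positivity) hdec
  exact ⟨this.1.trans hmono, this.2.trans hmono⟩

theorem exists_bound_iteratedDeriv {g : ℝ → ℂ} (hg : ContDiff ℝ ∞ g) (hc : HasCompactSupport g)
    (N : ℕ) : ∃ D : ℝ, 0 ≤ D ∧ ∀ n ≤ N, ∀ x, ‖iteratedFDeriv ℝ n g x‖ ≤ D := by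
  have h : ∀ n : ℕ, ∃ D : ℝ, ∀ x, ‖iteratedFDeriv ℝ n g x‖ ≤ D := fun n =>
    (hc.iteratedFDeriv n).exists_bound_of_continuous
      (hg.continuous_iteratedFDeriv (by exact_mod_cast le_top))
  choose D hD using h
  refine ⟨∑ n ∈ Finset.range (N + 1), |D n|, by positivity, fun n hn x => (hD n x).trans ?_⟩
  exact (le_abs_self _).trans (Finset.single_le_sum (f := fun n => |D n|) (fun _ _ => abs_nonneg _)
    (Finset.mem_range.2 (by omega)))

/-- The Sobolev norms of the truncated Schrödinger multipliers. -/
theorem exists_sobolevNorm_schrodinger_le {χ₀ : ℝ → ℂ} (hsmooth : ContDiff ℝ ∞ χ₀)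
    (hcompact : HasCompactSupport χ₀) (hsupp : tsupport χ₀ ⊆ Set.Ioo (-1 / 2) (1 / 2)) {s : ℝ}
    (hs : 0 ≤ s) : ∃ C : ℝ, 0 < C ∧ ∀ t : ℝ,
      sobolevNorm ⊤ s (schrodinger χ₀ t) ≤ ENNReal.ofReal (C * (1 + |t|) ^ s) ∧
      sobolevNorm 2 s (schrodinger χ₀ t) ≤ ENNReal.ofReal (C * (1 + |t|) ^ s) := by
  obtain ⟨D, hD0, hD⟩ := exists_bound_iteratedDeriv hsmooth hcompact ⌈s + 2⌉₊
  have := decayConst_pos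
  refine ⟨2 ^ ⌈s + 2⌉₊ * (8 * (D + 1)) * decayConst, by positivity, fun t => ?_⟩
  refine sobolevNorm_modulation_le hs hsmooth ?_ (D := D + 1) (fun x => ?_) (fun x => ?_) t
  · refine hsupp.trans fun x hx => ⟨?_, ?_⟩ <;> linarith [hx.1, hx.2]
  · have := hD 0 (by omega) x
    rw [norm_iteratedFDeriv_zero] at this
    linarith
  · have := hD _ le_rfl x
    rw [norm_iteratedFDeriv_eq_norm_iteratedDeriv] at this
    linarith

/-- The localized and rescaled Schrödinger multipliers are controlled in the `L²` Sobolev norm,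
uniformly in the scale. -/
theorem exists_sobolevNorm_schrodinger_localized_le {χ₀ : ℝ → ℂ} (hsmooth : ContDiff ℝ ∞ χ₀)
    (hcompact : HasCompactSupport χ₀) {χ : ℝ → ℝ} (hχ : ContDiff ℝ ∞ χ)
    (hχc : HasCompactSupport χ) (hχs : tsupport χ ⊆ Set.Ioo (3 / 4) (5 / 4)) {s : ℝ}
    (hs : 0 ≤ s) : ∃ C : ℝ, 0 < C ∧ ∀ t : ℝ, ∀ r ∈ Set.Ioc (0 : ℝ) 2,
      sobolevNorm 2 s (fun x => schrodinger χ₀ t (r * x) * (χ x : ℂ)) ≤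
        ENNReal.ofReal (C * (1 + 2 * |t|) ^ s) := by
  set N := ⌈s + 2⌉₊ with hN
  have hχ' : ContDiff ℝ ∞ (fun x => (χ x : ℂ)) := Complex.ofRealCLM.contDiff.comp hχ
  have hsub : Function.support (fun x => (χ x : ℂ)) = Function.support χ := by
    ext x; simp
  have hts : tsupport (fun x => (χ x : ℂ)) = tsupport χ := congrArg closure hsub
  have hχc' : HasCompactSupport (fun x => (χ x : ℂ)) := by
    rw [HasCompactSupport, hts]; exact hχc
  obtain ⟨D, hD0, hD⟩ := exists_bound_iteratedDeriv hsmooth hcompact N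
  obtain ⟨E, hE0, hE⟩ := exists_bound_iteratedDeriv hχ' hχc' N
  have hdc := decayConst_pos
  -- Bounds for the function and, by Leibniz, for its `N`-th derivative: one `2 ^ N` is the sum of
  -- the binomial coefficients, the other bounds the powers of `r ≤ 2` produced by dilation.
  set B : ℝ := D * E + 2 ^ N * (2 ^ N * D * E) with hB
  have hB0 : 0 ≤ B := by positivity
  refine ⟨2 ^ N * (8 * (B + 1)) * decayConst, by positivity, fun t r hr => ?_⟩
  have hsm : ContDiff ℝ ∞ (fun x => χ₀ (r * x)) := hsmooth.comp (contDiff_const.mul contDiff_id)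
  have hbr : ∀ n ≤ N, ∀ x, ‖iteratedFDeriv ℝ n (fun x => χ₀ (r * x)) x‖ ≤ 2 ^ N * D := by
    intro n hn x
    have h1 := congrFun (iteratedDeriv_comp_const_smul (n := n) (f := χ₀)
      (hsmooth.of_le (by exact_mod_cast le_top)) r) x
    rw [norm_iteratedFDeriv_eq_norm_iteratedDeriv, h1, norm_smul, norm_pow,
      ← norm_iteratedFDeriv_eq_norm_iteratedDeriv, Real.norm_of_nonneg hr.1.le]
    have h2 : r ^ n ≤ 2 ^ N := calc
      r ^ n ≤ 2 ^ n := pow_le_pow_left₀ hr.1.le hr.2 n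
      _ ≤ 2 ^ N := pow_le_pow_right₀ (by norm_num) hn
    exact mul_le_mul h2 (hD n hn _) (norm_nonneg _) (by positivity)
  have hg : ContDiff ℝ ∞ (fun x => χ₀ (r * x) * (χ x : ℂ)) := hsm.mul hχ'
  have hgs : tsupport (fun x => χ₀ (r * x) * (χ x : ℂ)) ⊆ Set.Icc (-2) 2 := by
    refine (tsupport_mul_subset_right (f := fun x => χ₀ (r * x))
      (g := fun x => (χ x : ℂ))).trans ?_
    rw [hts]
    refine hχs.trans fun x hx => ⟨?_, ?_⟩ <;> linarith [hx.1, hx.2]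
  have h0 : ∀ x, ‖χ₀ (r * x) * (χ x : ℂ)‖ ≤ B + 1 := by
    intro x
    have h1 := hD 0 (by omega) (r * x)
    have h2 := hE 0 (by omega) x
    rw [norm_iteratedFDeriv_zero] at h1 h2
    rw [norm_mul]
    have := mul_le_mul h1 h2 (norm_nonneg _) hD0
    have h3 : 0 ≤ 2 ^ N * (2 ^ N * D * E) := by positivity
    linarith
  have hNb : ∀ x, ‖iteratedDeriv N (fun x => χ₀ (r * x) * (χ x : ℂ)) x‖ ≤ B + 1 := by
    intro x
    rw [← norm_iteratedFDeriv_eq_norm_iteratedDeriv]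
    refine (norm_iteratedFDeriv_mul_le (N := N) (hsm.of_le (by exact_mod_cast le_top))
      (hχ'.of_le (by exact_mod_cast le_top)) x le_rfl).trans ?_
    have h1 : ∑ i ∈ Finset.range (N + 1), (N.choose i : ℝ) *
        ‖iteratedFDeriv ℝ i (fun x => χ₀ (r * x)) x‖ *
        ‖iteratedFDeriv ℝ (N - i) (fun x => (χ x : ℂ)) x‖ ≤
        ∑ i ∈ Finset.range (N + 1), (N.choose i : ℝ) * (2 ^ N * D * E) := by
      refine Finset.sum_le_sum fun i hi => ?_
      rw [mul_assoc]
      have hi' : i ≤ N := by have := Finset.mem_range.1 hi; omega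
      gcongr
      · exact hbr i hi' x
      · exact hE _ (by omega) x
    rw [← Finset.sum_mul] at h1
    have h2 : (∑ i ∈ Finset.range (N + 1), (N.choose i : ℝ)) = 2 ^ N := by
      exact_mod_cast Nat.sum_range_choose N
    rw [h2] at h1
    have h3 : 0 ≤ D * E := by positivity
    linarith
  -- Dilation by `r` turns the frequency `t` into `t * r`, and `|t * r| ≤ 2 * |t|`.
  have hmain := (sobolevNorm_modulation_le hs hg hgs h0 hNb (t * r)).2
  have heq : (fun x => schrodinger χ₀ t (r * x) * (χ x : ℂ)) =
      fun x : ℝ => Complex.exp (Complex.I * (t * r : ℝ) * x) * (χ₀ (r * x) * (χ x : ℂ)) := by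
    ext x
    unfold schrodinger
    push_cast
    ring_nf
  rw [heq]
  refine hmain.trans (ENNReal.ofReal_le_ofReal ?_)
  gcongr
  rw [abs_mul, abs_of_pos hr.1, mul_comm]
  gcongr
  exact hr.2

end SobolevBounds

/-! ### Sine coefficients, their differences, and Parseval's identity -/

section SineCoefficients

open Complex

/-- The sine coefficients of `θ ↦ F(1 - cos θ) sin θ`, that is, the coefficients of the expansion
of `F(1 - x)` in Chebyshev polynomials of the second kind (shifted by one). -/
def sineCoeff (F : ℝ → ℂ) (n : ℤ) : ℂ :=
  (1 / Real.pi : ℝ) * ∫ θ in -Real.pi..Real.pi,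
    F (1 - Real.cos θ) * (Real.sin θ : ℂ) * (Real.sin (n * θ) : ℂ)

theorem sineCoeff_intervalIntegrable {F : ℝ → ℂ} (hF : Continuous F) (n : ℤ) (a b : ℝ) :
    IntervalIntegrable (fun θ : ℝ =>
      F (1 - Real.cos θ) * (Real.sin θ : ℂ) * (Real.sin (n * θ) : ℂ)) volume a b := by
  refine Continuous.intervalIntegrable ?_ _ _
  fun_prop

theorem sineCoeff_add {F G : ℝ → ℂ} (hF : Continuous F) (hG : Continuous G) (n : ℤ) :
    sineCoeff (fun x => F x + G x) n = sineCoeff F n + sineCoeff G n := by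
  unfold sineCoeff
  rw [← mul_add, ← intervalIntegral.integral_add (sineCoeff_intervalIntegrable hF n _ _)
    (sineCoeff_intervalIntegrable hG n _ _)]
  congr 2
  ext θ
  ring

theorem sineCoeff_const_mul (c : ℂ) (F : ℝ → ℂ) (n : ℤ) :
    sineCoeff (fun x => c * F x) n = c * sineCoeff F n := by
  unfold sineCoeff
  simp_rw [mul_assoc c]
  rw [intervalIntegral.integral_const_mul]
  ring

theorem sineCoeff_sub {F G : ℝ → ℂ} (hF : Continuous F) (hG : Continuous G) (n : ℤ) :
    sineCoeff (fun x => F x - G x) n = sineCoeff F n - sineCoeff G n := by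
  have h := sineCoeff_add hF (G := fun x => (-1) * G x) (by fun_prop) n
  rw [sineCoeff_const_mul] at h
  simpa [sub_eq_add_neg] using h

/-- Only the values of `F` on `[0, 2]`, the range of `1 - cos θ`, enter; the factor 2 is the length
`2π` over `π`. -/
theorem norm_sineCoeff_le {F : ℝ → ℂ} {M : ℝ} (hM : ∀ x ∈ Set.Icc (0 : ℝ) 2, ‖F x‖ ≤ M) (n : ℤ) :
    ‖sineCoeff F n‖ ≤ 2 * M := by
  have hpi := Real.pi_pos
  have h : ‖∫ θ in -Real.pi..Real.pi,
      F (1 - Real.cos θ) * (Real.sin θ : ℂ) * (Real.sin (n * θ) : ℂ)‖ ≤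
      M * |Real.pi - -Real.pi| := by
    refine intervalIntegral.norm_integral_le_of_norm_le_const fun θ _ => ?_
    have h1 := hM (1 - Real.cos θ) ⟨by linarith [Real.cos_le_one θ],
      by linarith [Real.neg_one_le_cos θ]⟩
    rw [norm_mul, norm_mul, norm_real, norm_real, Real.norm_eq_abs, Real.norm_eq_abs]
    have h2 := Real.abs_sin_le_one θ
    have h3 := Real.abs_sin_le_one (n * θ)
    have h4 : ‖F (1 - Real.cos θ)‖ * |Real.sin θ| ≤ M :=
      (mul_le_of_le_one_right (norm_nonneg _) h2).trans h1
    exact (mul_le_of_le_one_right (by positivity) h3).trans h4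
  unfold sineCoeff
  rw [norm_mul, norm_real, Real.norm_of_nonneg (by positivity)]
  rw [abs_of_pos (by linarith)] at h
  calc _ ≤ 1 / Real.pi * (M * (Real.pi - -Real.pi)) := by gcongr
    _ = 2 * M := by field_simp; ring

theorem exists_norm_sineCoeff_le {F : ℝ → ℂ} (hF : Continuous F) :
    ∃ M : ℝ, ∀ n, ‖sineCoeff F n‖ ≤ M := by
  obtain ⟨C, hC⟩ := (isCompact_Icc (a := (0 : ℝ)) (b := 2)).exists_bound_of_continuousOn
    hF.continuousOn
  exact ⟨2 * C, norm_sineCoeff_le hC⟩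

theorem sineCoeff_neg (F : ℝ → ℂ) (n : ℤ) : sineCoeff F (-n) = -sineCoeff F n := by
  unfold sineCoeff
  rw [← mul_neg, ← intervalIntegral.integral_neg]
  congr 2
  ext θ
  push_cast
  rw [neg_mul, sin_neg, mul_neg]

theorem integral_cos_int_mul (k : ℤ) :
    ∫ θ in -Real.pi..Real.pi, Real.cos (k * θ) = if k = 0 then 2 * Real.pi else 0 := by
  split_ifs with hk
  · subst hk
    simp
    ring
  · have hk' : (k : ℝ) ≠ 0 := by exact_mod_cast hk
    rw [intervalIntegral.integral_comp_mul_left (fun x => Real.cos x) hk', integral_cos,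
      mul_neg, Real.sin_neg, Real.sin_int_mul_pi]
    simp

theorem integral_sin_mul_sin (m n : ℕ) (hm : 1 ≤ m) (hn : 1 ≤ n) :
    ∫ θ in -Real.pi..Real.pi, Real.sin (m * θ) * Real.sin (n * θ) =
      if m = n then Real.pi else 0 := by
  have h : ∀ θ : ℝ, Real.sin (m * θ) * Real.sin (n * θ) =
      (1 / 2) * Real.cos (((m : ℤ) - (n : ℤ) : ℤ) * θ) -
        (1 / 2) * Real.cos (((m : ℤ) + (n : ℤ) : ℤ) * θ) := by
    intro θ
    push_cast
    rw [sub_mul, add_mul, Real.cos_sub, Real.cos_add]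
    ring
  simp_rw [h]
  rw [intervalIntegral.integral_sub (Continuous.intervalIntegrable (by fun_prop) _ _)
    (Continuous.intervalIntegrable (by fun_prop) _ _), intervalIntegral.integral_const_mul,
    intervalIntegral.integral_const_mul, integral_cos_int_mul, integral_cos_int_mul,
    if_neg (c := (m : ℤ) + n = 0) (by omega)]
  by_cases hmn : m = n
  · subst hmn
    simp
  · rw [if_neg (by omega), if_neg hmn]
    simp

/-- Orthogonality of the Chebyshev polynomials of the second kind. -/
theorem sineCoeff_chebyshev (k n : ℕ) (hn : 1 ≤ n) :
    sineCoeff (fun x : ℝ => (Polynomial.Chebyshev.U ℂ k).eval (1 - (x : ℂ))) n =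
      if n = k + 1 then 1 else 0 := by
  unfold sineCoeff
  have h : ∀ θ : ℝ, (Polynomial.Chebyshev.U ℂ k).eval (1 - ((1 - Real.cos θ : ℝ) : ℂ)) *
      (Real.sin θ : ℂ) * (Real.sin ((n : ℤ) * θ) : ℂ) =
      ((Real.sin ((k + 1 : ℕ) * θ) * Real.sin (n * θ) : ℝ) : ℂ) := by
    intro θ
    have h1 := Polynomial.Chebyshev.U_complex_cos (θ : ℂ) k
    push_cast at h1 ⊢
    rw [sub_sub_cancel, h1]
  simp_rw [h]
  rw [intervalIntegral.integral_ofReal, integral_sin_mul_sin _ _ (by omega) hn]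
  have hpi : (Real.pi : ℂ) ≠ 0 := by exact_mod_cast Real.pi_ne_zero
  by_cases hkn : n = k + 1
  · rw [if_pos hkn.symm, if_pos hkn]
    push_cast
    field_simp
  · rw [if_neg (Ne.symm hkn), if_neg hkn]
    simp

/-- The sine coefficients as Fourier coefficients. -/
theorem sineCoeff_eq_fourier {F : ℝ → ℂ} (hF : Continuous F) (n : ℤ) :
    sineCoeff F n = (I / Real.pi) * ∫ θ in -Real.pi..Real.pi,
      F (1 - Real.cos θ) * (Real.sin θ : ℂ) * exp (-(I * n * θ)) := by
  have hodd : ∫ θ in -Real.pi..Real.pi,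
      F (1 - Real.cos θ) * (Real.sin θ : ℂ) * (Real.cos (n * θ) : ℂ) = 0 := by
    have h1 := intervalIntegral.integral_comp_neg (a := -Real.pi) (b := Real.pi)
      (fun θ : ℝ => F (1 - Real.cos θ) * (Real.sin θ : ℂ) * (Real.cos (n * θ) : ℂ))
    rw [neg_neg] at h1
    have h2 : (∫ θ in -Real.pi..Real.pi, F (1 - Real.cos (-θ)) * (Real.sin (-θ) : ℂ) *
        (Real.cos (n * -θ) : ℂ)) = -∫ θ in -Real.pi..Real.pi,
      F (1 - Real.cos θ) * (Real.sin θ : ℂ) * (Real.cos (n * θ) : ℂ) := by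
      rw [← intervalIntegral.integral_neg]
      congr 1
      ext θ
      rw [Real.cos_neg, Real.sin_neg, mul_neg, Real.cos_neg]
      push_cast
      ring
    rw [h2] at h1
    exact self_eq_neg.1 h1.symm
  have hsplit : ∀ θ : ℝ, F (1 - Real.cos θ) * (Real.sin θ : ℂ) * exp (-(I * n * θ)) =
      F (1 - Real.cos θ) * (Real.sin θ : ℂ) * (Real.cos (n * θ) : ℂ) +
      (-I) * (F (1 - Real.cos θ) * (Real.sin θ : ℂ) * (Real.sin (n * θ) : ℂ)) := by
    intro θ
    have : exp (-(I * n * θ)) = exp ((-(n * θ : ℝ) : ℂ) * I) := by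
      congr 1; push_cast; ring
    rw [this, exp_mul_I, cos_neg, sin_neg]
    push_cast
    ring
  simp_rw [hsplit]
  rw [intervalIntegral.integral_add (Continuous.intervalIntegrable (by fun_prop) _ _)
    (Continuous.intervalIntegrable (by fun_prop) _ _), hodd, zero_add,
    intervalIntegral.integral_const_mul]
  unfold sineCoeff
  push_cast
  rw [← mul_assoc]
  congr 1
  have := I_mul_I
  rw [div_mul_eq_mul_div, mul_neg, this]
  simp

/-- Differences of consecutive sine coefficients. -/
def sineDiff (F : ℝ → ℂ) (n : ℤ) : ℂ := sineCoeff F (n + 1) - sineCoeff F n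

/-- The reflection `n ↦ -(n + 1)` exchanges negative and nonnegative indices, so the sum over `ℤ` in
Parseval's identity is twice the sum over `ℕ`. -/
theorem sineDiff_neg (F : ℝ → ℂ) (n : ℤ) : sineDiff F (-(n + 1)) = sineDiff F n := by
  unfold sineDiff
  rw [show -(n + 1) + 1 = -n by ring, sineCoeff_neg, sineCoeff_neg]
  ring

/-- The function whose Fourier coefficients are the differences of the sine coefficients. -/
def sineDiffDensity (F : ℝ → ℂ) (θ : ℝ) : ℂ :=
  F (1 - Real.cos θ) * ((Real.sin θ : ℂ) * (exp (-(I * θ)) - 1))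

theorem sineDiff_eq_fourier {F : ℝ → ℂ} (hF : Continuous F) (n : ℤ) :
    sineDiff F n = (I / Real.pi) * ∫ θ in -Real.pi..Real.pi,
      sineDiffDensity F θ * exp (-(I * n * θ)) := by
  unfold sineDiff
  rw [sineCoeff_eq_fourier hF, sineCoeff_eq_fourier hF, ← mul_sub, ← intervalIntegral.integral_sub
    (Continuous.intervalIntegrable (by fun_prop) _ _)
    (Continuous.intervalIntegrable (by fun_prop) _ _)]
  congr 2
  ext θ
  have : exp (-(I * ((n + 1 : ℤ) : ℂ) * θ)) = exp (-(I * θ)) * exp (-(I * n * θ)) := by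
    rw [← exp_add]
    congr 1
    push_cast
    ring
  rw [this, sineDiffDensity]
  ring

theorem continuous_sineDiffDensity {F : ℝ → ℂ} (hF : Continuous F) :
    Continuous (sineDiffDensity F) := by
  unfold sineDiffDensity
  fun_prop

/-- Parseval's identity on `[-π, π]`. The constant is `4 · (2π)⁻¹ · 1/2`: the differences are `2i`
times Fourier coefficients, and the sum over `ℤ` is folded in half. -/
theorem hasSum_sq_sineDiff {F : ℝ → ℂ} (hF : Continuous F) :
    HasSum (fun n : ℕ => ‖sineDiff F n‖ ^ 2)
      (Real.pi⁻¹ * ∫ θ in -Real.pi..Real.pi, ‖sineDiffDensity F θ‖ ^ 2) := by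
  have hpi := Real.pi_pos
  have hab : -Real.pi < Real.pi := by linarith
  have hcont := continuous_sineDiffDensity hF
  have hL2 : MemLp (sineDiffDensity F) 2 (volume.restrict (Set.Ioc (-Real.pi) Real.pi)) := by
    obtain ⟨C, hC⟩ := (isCompact_Icc (a := -Real.pi) (b := Real.pi)).exists_bound_of_continuousOn
      hcont.continuousOn
    exact MemLp.of_bound hcont.aestronglyMeasurable C
      ((ae_restrict_iff' measurableSet_Ioc).2 (Eventually.of_forall fun x hx =>
        hC x (Set.Ioc_subset_Icc_self hx)))
  have h := hasSum_sq_fourierCoeffOn hab hL2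
  have hcoef : ∀ n : ℤ, sineDiff F n = 2 * I * fourierCoeffOn hab (sineDiffDensity F) n := by
    intro n
    rw [sineDiff_eq_fourier hF, fourierCoeffOn_eq_integral]
    have : ∀ θ : ℝ, fourier (-n) (θ : AddCircle (Real.pi - -Real.pi)) • sineDiffDensity F θ =
        sineDiffDensity F θ * exp (-(I * n * θ)) := by
      intro θ
      rw [fourier_coe_apply, smul_eq_mul, mul_comm]
      congr 2
      have hpi : (Real.pi : ℂ) ≠ 0 := by exact_mod_cast Real.pi_ne_zero
      push_cast
      field_simp
      ring
    simp_rw [this]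
    rw [Complex.real_smul, ← mul_assoc]
    congr 1
    have hpi : (Real.pi : ℂ) ≠ 0 := by exact_mod_cast Real.pi_ne_zero
    push_cast
    field_simp
    ring
  have h2 : HasSum (fun n : ℤ => ‖sineDiff F n‖ ^ 2)
      (4 * ((Real.pi - -Real.pi)⁻¹ • ∫ x in -Real.pi..Real.pi, ‖sineDiffDensity F x‖ ^ 2)) := by
    refine (h.mul_left 4).congr_fun fun n => ?_
    rw [hcoef, norm_mul, mul_pow, norm_mul]
    norm_num
  have h3 := h2.nat_add_neg_add_one
  have h4 : ∀ n : ℕ, ‖sineDiff F n‖ ^ 2 + ‖sineDiff F (-(n + 1))‖ ^ 2 =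
      2 * ‖sineDiff F n‖ ^ 2 := by
    intro n
    rw [sineDiff_neg]
    ring
  simp_rw [h4] at h3
  have h5 := h3.mul_left (1 / 2)
  have h6 : Real.pi⁻¹ * ∫ θ in -Real.pi..Real.pi, ‖sineDiffDensity F θ‖ ^ 2 =
      1 / 2 * (4 * ((Real.pi - -Real.pi)⁻¹ •
        ∫ x in -Real.pi..Real.pi, ‖sineDiffDensity F x‖ ^ 2)) := by
    rw [smul_eq_mul]
    field_simp
    ring
  rw [h6]
  refine h5.congr_fun fun n => ?_
  ring

end SineCoefficients

/-! ### Van der Corput's lemma -/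

section VanDerCorput

open Complex

/-- Van der Corput's estimate for oscillatory integrals with a lower bound for the second
derivative of the phase and an amplitude vanishing at the endpoints. -/
theorem norm_oscillatory_integral_le {a b T A B : ℝ} (hab : a ≤ b) (hT : 0 < T)
    {φ φ' φ'' : ℝ → ℝ} {ψ ψ' : ℝ → ℂ} (hφ : ∀ x, HasDerivAt φ (φ' x) x)
    (hφ' : ∀ x, HasDerivAt φ' (φ'' x) x) (hφ'' : Continuous φ'')
    (hψ : ∀ x, HasDerivAt ψ (ψ' x) x) (hψ' : Continuous ψ')
    (hlow : ∀ x ∈ Set.Icc a b, T ≤ φ'' x) (ha : ψ a = 0) (hb : ψ b = 0)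
    (hA : ∀ x ∈ Set.Icc a b, ‖ψ x‖ ≤ A) (hB : ∀ x ∈ Set.Icc a b, ‖ψ' x‖ ≤ B) :
    ‖∫ x in a..b, ψ x * exp (I * φ x)‖ ≤ (B * (b - a) + 2 * Real.pi * A) / √T := by
  have hφc : Continuous φ := continuous_iff_continuousAt.2 fun x => (hφ x).continuousAt
  have hφc' : Continuous φ' := continuous_iff_continuousAt.2 fun x => (hφ' x).continuousAt
  have hψc : Continuous ψ := continuous_iff_continuousAt.2 fun x => (hψ x).continuousAt
  have hs : 0 < √T := Real.sqrt_pos.2 hT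
  have hss : √T * √T = T := Real.mul_self_sqrt hT.le
  have hden : ∀ x, 0 < φ' x ^ 2 + T := fun x => by positivity
  have hden' : ∀ x, φ' x ^ 2 + T ≠ 0 := fun x => (hden x).ne'
  have hA0 : 0 ≤ A := (norm_nonneg _).trans (hA a ⟨le_rfl, hab⟩)
  have hB0 : 0 ≤ B := (norm_nonneg _).trans (hB a ⟨le_rfl, hab⟩)
  -- A regularization of the usual `1 / φ'`: it stays bounded at stationary points, so one
  -- integration by parts covers the whole interval without splitting it.
  set w : ℝ → ℝ := fun x => φ' x / (φ' x ^ 2 + T) with hw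
  set w' : ℝ → ℝ := fun x => φ'' x * (T - φ' x ^ 2) / (φ' x ^ 2 + T) ^ 2 with hw'
  have hwd : ∀ x, HasDerivAt w (w' x) x := by
    intro x
    have h1 := (hφ' x).div (((hφ' x).pow 2).add_const T) (hden' x)
    refine h1.congr_deriv ?_
    simp only [hw', Pi.pow_apply]
    push_cast
    ring
  have hwc : Continuous w := by
    simp only [hw]
    exact hφc'.div (by fun_prop) hden'
  have hwc' : Continuous w' := by
    simp only [hw']
    exact Continuous.div (by fun_prop) (by fun_prop) fun x => pow_ne_zero 2 (hden' x)
  set E : ℝ → ℂ := fun x => exp (I * φ x) with hE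
  have hEd : ∀ x, HasDerivAt E (E x * (I * φ' x)) x := fun x =>
    (((hφ x).ofReal_comp).const_mul I).cexp
  have hEc : Continuous E := by simp only [hE]; fun_prop
  have hEn : ∀ x, ‖E x‖ = 1 := fun x => by
    simp only [hE]; rw [mul_comm]; exact norm_exp_ofReal_mul_I _
  set P' : ℝ → ℂ := fun x =>
    (ψ' x * w x + ψ x * w' x) * E x + (ψ x * w x) * (E x * (I * φ' x)) with hP'
  have hPd : ∀ x, HasDerivAt (fun x => (ψ x * w x) * E x) (P' x) x := fun x =>
    ((hψ x).mul (hwd x).ofReal_comp).mul (hEd x)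
  have hPc : Continuous P' := by
    simp only [hP']
    fun_prop
  have hFTC : ∫ x in a..b, P' x = 0 := by
    rw [intervalIntegral.integral_eq_sub_of_hasDerivAt (fun x _ => hPd x)
      (hPc.intervalIntegrable _ _), ha, hb]
    simp
  have hsub : ∫ x in a..b, ψ x * E x = ∫ x in a..b, (ψ x * E x - (-I) * P' x) := by
    rw [intervalIntegral.integral_sub
      (Continuous.intervalIntegrable (by fun_prop) _ _)
      (Continuous.intervalIntegrable (by fun_prop) _ _), intervalIntegral.integral_const_mul,
      hFTC, mul_zero, sub_zero]
  rw [hsub]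
  set g : ℝ → ℝ := fun x => B / (2 * √T) + 2 * A * (φ'' x / (φ' x ^ 2 + T)) with hg
  have hgc : Continuous g := by
    simp only [hg]
    have : Continuous fun x => φ'' x / (φ' x ^ 2 + T) := hφ''.div (by fun_prop) hden'
    fun_prop
  have hpt : ∀ x ∈ Set.Icc a b, ‖ψ x * E x - (-I) * P' x‖ ≤ g x := by
    intro x hx
    have hd := hden x
    have hlx := hlow x hx
    -- Subtracting the exact derivative leaves `1 - w φ' = T / (φ'² + T)` in front of `ψ`, besides
    -- the terms containing `ψ'` and `w'`.
    have e1 : ψ x * E x - (-I) * P' x =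
        (I * (ψ' x * w x + ψ x * w' x) + ψ x * ((T / (φ' x ^ 2 + T) : ℝ) : ℂ)) * E x := by
      have e2 : (w x * φ' x : ℝ) = 1 - T / (φ' x ^ 2 + T) := by
        simp only [hw]; field_simp; ring
      have e3 : (w x : ℂ) * φ' x = 1 - ((T / (φ' x ^ 2 + T) : ℝ) : ℂ) := by
        rw [← ofReal_mul, e2]; push_cast; rfl
      have e4 : (ψ x * w x) * (E x * (I * φ' x)) =
          ψ x * E x * I * (1 - ((T / (φ' x ^ 2 + T) : ℝ) : ℂ)) := by
        rw [← e3]; ring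
      simp only [hP']
      rw [e4]
      linear_combination (ψ x * E x * (1 - ((T / (φ' x ^ 2 + T) : ℝ) : ℂ)) ) * I_sq
    have b1 : |w x| ≤ 1 / (2 * √T) := by
      simp only [hw]
      rw [abs_div, abs_of_pos hd, div_le_div_iff₀ hd (by positivity)]
      nlinarith [sq_nonneg (|φ' x| - √T), sq_abs (φ' x)]
    have b2 : |w' x| ≤ φ'' x / (φ' x ^ 2 + T) := by
      simp only [hw']
      rw [abs_div, abs_mul, abs_of_pos (hT.trans_le hlx), abs_of_pos (pow_pos hd 2),
        div_le_div_iff₀ (pow_pos hd 2) hd]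
      have : |T - φ' x ^ 2| ≤ φ' x ^ 2 + T := by
        rw [abs_le]; constructor <;> nlinarith [sq_nonneg (φ' x)]
      have hp : 0 ≤ φ'' x := hT.le.trans hlx
      calc φ'' x * |T - φ' x ^ 2| * (φ' x ^ 2 + T)
          ≤ φ'' x * (φ' x ^ 2 + T) * (φ' x ^ 2 + T) := by gcongr
        _ = _ := by ring
    have b3 : T / (φ' x ^ 2 + T) ≤ φ'' x / (φ' x ^ 2 + T) := by gcongr
    rw [e1, norm_mul, hEn, mul_one]
    calc _ ≤ ‖I * (ψ' x * w x + ψ x * w' x)‖ + ‖ψ x * ((T / (φ' x ^ 2 + T) : ℝ) : ℂ)‖ :=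
          norm_add_le _ _
      _ ≤ (‖ψ' x‖ * |w x| + ‖ψ x‖ * |w' x|) + ‖ψ x‖ * (T / (φ' x ^ 2 + T)) := by
          rw [norm_mul, norm_I, one_mul, norm_mul (ψ x), norm_real, Real.norm_of_nonneg
            (by positivity : 0 ≤ T / (φ' x ^ 2 + T))]
          gcongr
          refine (norm_add_le _ _).trans ?_
          rw [norm_mul, norm_mul, norm_real, norm_real, Real.norm_eq_abs, Real.norm_eq_abs]
      _ ≤ (B * (1 / (2 * √T)) + A * (φ'' x / (φ' x ^ 2 + T))) +
            A * (φ'' x / (φ' x ^ 2 + T)) := by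
          gcongr
          · exact hB x hx
          · exact hA x hx
          · exact hA x hx
      _ = g x := by simp only [hg]; ring
  -- Both `|w'|` and `T / (φ'² + T)` are dominated by `φ'' / (φ'² + T)`, which has an arctangent as
  -- primitive; its integral is at most `π / √T` whatever the length of the interval.
  have hatan : ∀ x, HasDerivAt (fun x => (1 / √T) * Real.arctan (φ' x / √T))
      (φ'' x / (φ' x ^ 2 + T)) x := by
    intro x
    have h1 := (((hφ' x).div_const (√T)).arctan).const_mul (1 / √T)
    refine h1.congr_deriv ?_
    have hd := hden x
    have : 1 + (φ' x / √T) ^ 2 = (φ' x ^ 2 + T) / T := by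
      rw [div_pow, sq (√T), hss]; field_simp; ring
    rw [this]
    field_simp
    rw [sq (√T), hss]
  have hatint : ∫ x in a..b, φ'' x / (φ' x ^ 2 + T) ≤ Real.pi / √T := by
    rw [intervalIntegral.integral_eq_sub_of_hasDerivAt (fun x _ => hatan x)
      ((hφ''.div (by fun_prop) hden').intervalIntegrable _ _)]
    rw [← mul_sub, one_div, div_eq_inv_mul Real.pi]
    refine mul_le_mul_of_nonneg_left ?_ (inv_nonneg.2 hs.le)
    linarith [Real.arctan_lt_pi_div_two (φ' b / √T), Real.neg_pi_div_two_lt_arctan (φ' a / √T)]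
  calc _ ≤ ∫ x in a..b, g x :=
        intervalIntegral.norm_integral_le_of_norm_le hab
          (Eventually.of_forall fun x hx => hpt x (Set.Ioc_subset_Icc_self hx))
          (hgc.intervalIntegrable _ _)
    _ = B / (2 * √T) * (b - a) + 2 * A * ∫ x in a..b, φ'' x / (φ' x ^ 2 + T) := by
        simp only [hg]
        have hqc : Continuous fun x => φ'' x / (φ' x ^ 2 + T) := hφ''.div (by fun_prop) hden'
        rw [intervalIntegral.integral_add (continuous_const.intervalIntegrable _ _)
          (Continuous.intervalIntegrable (by fun_prop) _ _), intervalIntegral.integral_const_mul,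
          intervalIntegral.integral_const, smul_eq_mul]
        ring
    _ ≤ B / √T * (b - a) + 2 * A * (Real.pi / √T) := by
        have : 0 ≤ b - a := by linarith
        gcongr
        linarith
    _ = _ := by ring

end VanDerCorput

/-! ### Dispersive decay and the `ℓ¹` tail of the coefficients -/

section DispersiveEstimate

open Complex

theorem continuous_schrodinger {χ₀ : ℝ → ℂ} (h : Continuous χ₀) (t : ℝ) :
    Continuous (schrodinger χ₀ t) := by
  unfold schrodinger
  fun_prop

theorem contDiff_schrodinger {χ₀ : ℝ → ℂ} (h : ContDiff ℝ ∞ χ₀) (t : ℝ) :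
    ContDiff ℝ ∞ (schrodinger χ₀ t) :=
  ((contDiff_const.mul Complex.ofRealCLM.contDiff).cexp).mul h

theorem norm_schrodinger (χ₀ : ℝ → ℂ) (t x : ℝ) : ‖schrodinger χ₀ t x‖ = ‖χ₀ x‖ := by
  unfold schrodinger
  have : I * t * x = ((t * x : ℝ) : ℂ) * I := by push_cast; ring
  rw [norm_mul, this, norm_exp_ofReal_mul_I, one_mul]

theorem sineDiffDensity_schrodinger (χ₀ : ℝ → ℂ) (t θ : ℝ) :
    sineDiffDensity (schrodinger χ₀ t) θ =
      sineDiffDensity χ₀ θ * exp (I * (t * (1 - Real.cos θ) : ℝ)) := by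
  unfold sineDiffDensity schrodinger
  push_cast
  ring_nf

theorem sineDiffDensity_eq_zero {χ₀ : ℝ → ℂ} (hsupp : tsupport χ₀ ⊆ Set.Ioo (-1 / 2) (1 / 2))
    {θ : ℝ} (h1 : Real.pi / 3 ≤ |θ|) (h2 : |θ| ≤ Real.pi) : sineDiffDensity χ₀ θ = 0 := by
  have hcos : Real.cos θ ≤ 1 / 2 := by
    rw [← Real.cos_abs, ← Real.cos_pi_div_three]
    exact Real.cos_le_cos_of_nonneg_of_le_pi (by positivity) h2 h1
  have : χ₀ (1 - Real.cos θ) = 0 := by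
    apply image_eq_zero_of_notMem_tsupport
    intro h
    have := (hsupp h).2
    linarith
  rw [sineDiffDensity, this, zero_mul]

theorem contDiff_sineDiffDensity {χ₀ : ℝ → ℂ} (h : ContDiff ℝ ∞ χ₀) :
    ContDiff ℝ ∞ (sineDiffDensity χ₀) := by
  unfold sineDiffDensity
  refine (h.comp (contDiff_const.sub Real.contDiff_cos)).mul ?_
  refine (Complex.ofRealCLM.contDiff.comp Real.contDiff_sin).mul ?_
  exact ((contDiff_const.mul Complex.ofRealCLM.contDiff).neg.cexp).sub contDiff_const

/-- The dispersive estimate: the coefficients of the Schrödinger multipliers decay like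
`t^{-1/2}`. -/
theorem exists_norm_sineDiff_schrodinger_le {χ₀ : ℝ → ℂ} (hsmooth : ContDiff ℝ ∞ χ₀)
    (hsupp : tsupport χ₀ ⊆ Set.Ioo (-1 / 2) (1 / 2)) :
    ∃ C : ℝ, 0 < C ∧ ∀ t : ℝ, 0 < t → ∀ n : ℤ,
      ‖sineDiff (schrodinger χ₀ t) n‖ ≤ C / √t := by
  have hpi := Real.pi_pos
  have hψs := contDiff_sineDiffDensity hsmooth
  set ψ := sineDiffDensity χ₀ with hψ
  have hψ'c : Continuous (deriv ψ) := hψs.continuous_deriv (by exact_mod_cast le_top)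
  obtain ⟨A, hA⟩ := (isCompact_Icc (a := -(Real.pi / 3)) (b := Real.pi / 3)).exists_bound_of_continuousOn
    hψs.continuous.continuousOn
  obtain ⟨B, hB⟩ := (isCompact_Icc (a := -(Real.pi / 3)) (b := Real.pi / 3)).exists_bound_of_continuousOn
    hψ'c.continuousOn
  have hmem : (0 : ℝ) ∈ Set.Icc (-(Real.pi / 3)) (Real.pi / 3) := ⟨by linarith, by linarith⟩
  have hA0 : 0 ≤ A := (norm_nonneg _).trans (hA 0 hmem)
  have hB0 : 0 ≤ B := (norm_nonneg _).trans (hB 0 hmem)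
  set K := B * (Real.pi / 3 - -(Real.pi / 3)) + 2 * Real.pi * A with hK
  have hK0 : 0 ≤ K := by
    have : 0 ≤ Real.pi / 3 - -(Real.pi / 3) := by linarith
    positivity
  refine ⟨1 / Real.pi * (K * √2) + 1, by positivity, fun t ht n => ?_⟩
  rw [sineDiff_eq_fourier (continuous_schrodinger hsmooth.continuous t)]
  set φ : ℝ → ℝ := fun θ => t * (1 - Real.cos θ) - n * θ with hφ
  have hint : ∀ θ : ℝ, sineDiffDensity (schrodinger χ₀ t) θ * exp (-(I * n * θ)) =
      ψ θ * exp (I * φ θ) := by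
    intro θ
    rw [sineDiffDensity_schrodinger, mul_assoc, ← exp_add]
    congr 2
    simp only [hφ]
    push_cast
    ring
  simp_rw [hint]
  have hc : Continuous fun θ => ψ θ * exp (I * φ θ) := by
    have := hψs.continuous
    simp only [hφ]
    fun_prop
  have hout1 : ∫ θ in -Real.pi..-(Real.pi / 3), ψ θ * exp (I * φ θ) = 0 := by
    rw [intervalIntegral.integral_congr (g := fun _ => 0) ?_]
    · simp
    · intro θ hθ
      rw [Set.uIcc_of_le (by linarith)] at hθ
      have : |θ| = -θ := abs_of_nonpos (by linarith [hθ.2])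
      simp only [hψ, sineDiffDensity_eq_zero hsupp (θ := θ) (by linarith [hθ.2])
        (by linarith [hθ.1]), zero_mul]
  have hout2 : ∫ θ in Real.pi / 3..Real.pi, ψ θ * exp (I * φ θ) = 0 := by
    rw [intervalIntegral.integral_congr (g := fun _ => 0) ?_]
    · simp
    · intro θ hθ
      rw [Set.uIcc_of_le (by linarith)] at hθ
      have : |θ| = θ := abs_of_nonneg (by linarith [hθ.1])
      simp only [hψ, sineDiffDensity_eq_zero hsupp (θ := θ) (by linarith [hθ.1])
        (by linarith [hθ.2]), zero_mul]
  rw [← intervalIntegral.integral_add_adjacent_intervals (hc.intervalIntegrable (-Real.pi)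
    (-(Real.pi / 3))) (hc.intervalIntegrable _ _), hout1, zero_add,
    ← intervalIntegral.integral_add_adjacent_intervals (hc.intervalIntegrable (-(Real.pi / 3))
    (Real.pi / 3)) (hc.intervalIntegrable _ _), hout2, add_zero]
  have hend : ∀ θ : ℝ, |θ| = Real.pi / 3 → ψ θ = 0 := fun θ h =>
    sineDiffDensity_eq_zero hsupp (by linarith) (by linarith)
  -- The amplitude lives in `|θ| ≤ π / 3`, where `cos θ ≥ 1 / 2`, so the phase `t (1 - cos θ) - n θ`
  -- has second derivative at least `t / 2`, uniformly in `n`.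
  have hvdc := norm_oscillatory_integral_le (a := -(Real.pi / 3)) (b := Real.pi / 3) (T := t / 2)
    (A := A) (B := B) (by linarith) (by linarith) (φ := φ)
    (φ' := fun θ => t * Real.sin θ - n) (φ'' := fun θ => t * Real.cos θ) (ψ := ψ)
    (ψ' := deriv ψ)
    (fun θ => by
      have h := (((Real.hasDerivAt_cos θ).const_sub 1).const_mul t).sub
        ((hasDerivAt_id θ).const_mul (n : ℝ))
      refine h.congr_deriv ?_
      simp)
    (fun θ => ((Real.hasDerivAt_sin θ).const_mul t).sub_const _)
    (by fun_prop)
    (fun θ => (hψs.differentiable (by simp)).differentiableAt.hasDerivAt)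
    hψ'c
    (fun θ hθ => by
      have : 1 / 2 ≤ Real.cos θ := by
        rw [← Real.cos_abs θ, ← Real.cos_pi_div_three]
        exact Real.cos_le_cos_of_nonneg_of_le_pi (abs_nonneg _) (by linarith) (abs_le.2 hθ)
      nlinarith)
    (hend _ (by rw [abs_neg, abs_of_pos (by positivity)]))
    (hend _ (abs_of_pos (by positivity))) hA hB
  rw [norm_mul, norm_div, norm_I, norm_real, Real.norm_of_nonneg hpi.le]
  have hst : 0 < √t := Real.sqrt_pos.2 ht
  calc _ ≤ 1 / Real.pi * (K / √(t / 2)) := by gcongr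
    _ = 1 / Real.pi * (K * √2) / √t := by
        rw [Real.sqrt_div ht.le]
        field_simp
    _ ≤ _ := by
        gcongr
        linarith

/-- Lower bound for the tails of the coefficients of the Schrödinger multipliers. -/
theorem exists_le_tsum_sineDiff_schrodinger {χ₀ : ℝ → ℂ} (hsmooth : ContDiff ℝ ∞ χ₀)
    (hsupp : tsupport χ₀ ⊆ Set.Ioo (-1 / 2) (1 / 2))
    (hone : ∀ x ∈ Set.Icc (-1 / 4 : ℝ) (1 / 4), χ₀ x = 1) :
    ∃ t₀ c δ : ℝ, 1 ≤ t₀ ∧ 0 < c ∧ 0 < δ ∧ ∀ t : ℝ, t₀ ≤ t → ∃ N : ℕ, δ * t ≤ N ∧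
      ENNReal.ofReal (c * √t) ≤
        ∑' n : ℕ, ‖sineDiff (schrodinger χ₀ t) ((n + (N + 2) : ℕ) : ℤ)‖ₑ := by
  have hpi := Real.pi_pos
  obtain ⟨C, hC0, hC⟩ := exists_norm_sineDiff_schrodinger_le hsmooth hsupp
  set Q := Real.pi⁻¹ * ∫ θ in -Real.pi..Real.pi, ‖sineDiffDensity χ₀ θ‖ ^ 2 with hQ
  have hQpos : 0 < Q := by
    refine mul_pos (by positivity) ?_
    -- The density is nonzero at `θ = 1 / 2`: there `1 - cos θ ≤ 1 / 8`, so the cutoff equals one.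
    refine intervalIntegral.integral_pos (by linarith)
      (((contDiff_sineDiffDensity hsmooth).continuous.norm.pow 2).continuousOn)
      (fun θ _ => by positivity) ⟨1 / 2, ⟨by linarith [Real.pi_gt_three],
        by linarith [Real.pi_gt_three]⟩, ?_⟩
    have h1 : χ₀ (1 - Real.cos (1 / 2)) = 1 := by
      apply hone
      have := Real.one_sub_sq_div_two_le_cos (x := 1 / 2)
      have := Real.cos_le_one (1 / 2)
      constructor <;> linarith
    have hsin : 0 < Real.sin (1 / 2) :=
      Real.sin_pos_of_pos_of_lt_pi (by norm_num) (by linarith [Real.pi_gt_three])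
    have hne : sineDiffDensity χ₀ (1 / 2) ≠ 0 := by
      rw [sineDiffDensity, h1, one_mul]
      refine mul_ne_zero (by exact_mod_cast hsin.ne') fun h => ?_
      have h2 : exp (-(I * ((1 / 2 : ℝ) : ℂ))) = 1 := sub_eq_zero.1 h
      have h3 := congrArg Complex.im h2
      rw [show -(I * ((1 / 2 : ℝ) : ℂ)) = ((-(1 / 2) : ℝ) : ℂ) * I by push_cast; ring,
        exp_ofReal_mul_I_im, Real.sin_neg, one_im] at h3
      linarith
    positivity
  -- Chosen so that `2κt` terms, each at most `C² / t`, contribute `Q / 2`. The condition `κt ≥ 2`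
  -- gives both `N + 2 ≤ 2κt` and `N ≥ κt / 2`.
  set κ := Q / (4 * C ^ 2) with hκ
  have hκ0 : 0 < κ := by positivity
  refine ⟨max 1 (2 / κ), Q / (2 * C), κ / 2, le_max_left _ _, by positivity, by positivity,
    fun t ht => ?_⟩
  have ht1 : 1 ≤ t := (le_max_left _ _).trans ht
  have ht2 : 2 ≤ κ * t := by
    have := (le_max_right _ _).trans ht
    rw [div_le_iff₀ hκ0] at this
    linarith
  have ht0 : 0 < t := by linarith
  have hst : 0 < √t := Real.sqrt_pos.2 ht0
  set N := ⌊κ * t⌋₊ with hN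
  have hN1 : (N : ℝ) ≤ κ * t := Nat.floor_le (by positivity)
  have hN2 : κ * t < N + 1 := Nat.lt_floor_add_one _
  refine ⟨N, by linarith, ?_⟩
  set e : ℕ → ℂ := fun n => sineDiff (schrodinger χ₀ t) n with he
  have heC : ∀ n, ‖e n‖ ≤ C / √t := fun n => hC t ht0 n
  have hsum : HasSum (fun n => ‖e n‖ ^ 2) Q := by
    have h := hasSum_sq_sineDiff (continuous_schrodinger hsmooth.continuous t)
    simp only [sineDiffDensity, norm_mul, norm_schrodinger] at h
    simpa only [hQ, sineDiffDensity, norm_mul] using h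
  have hhead : ∑ n ∈ Finset.range (N + 2), ‖e n‖ ^ 2 ≤ Q / 2 := by
    calc ∑ n ∈ Finset.range (N + 2), ‖e n‖ ^ 2 ≤ ∑ n ∈ Finset.range (N + 2), (C / √t) ^ 2 :=
          Finset.sum_le_sum fun n _ => by gcongr; exact heC n
      _ = (N + 2) * (C ^ 2 / t) := by
          rw [Finset.sum_const, Finset.card_range, nsmul_eq_mul, div_pow, Real.sq_sqrt ht0.le]
          push_cast; ring
      _ ≤ (2 * κ * t) * (C ^ 2 / t) := by gcongr; linarith
      _ = Q / 2 := by rw [hκ]; field_simp; ring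
  have htail : Q / 2 ≤ ∑' n, ‖e (n + (N + 2))‖ ^ 2 := by
    have := hsum.summable.sum_add_tsum_nat_add (N + 2)
    rw [hsum.tsum_eq] at this
    linarith
  -- Interpolation: the `ℓ²` mass of the tail is at most its supremum `C / √t` times its `ℓ¹` norm.
  have htail' : ENNReal.ofReal (Q / 2) ≤ ENNReal.ofReal (C / √t) * ∑' n, ‖e (n + (N + 2))‖ₑ := by
    refine (ENNReal.ofReal_le_ofReal htail).trans ?_
    rw [ENNReal.ofReal_tsum_of_nonneg (fun n => by positivity)
      ((summable_nat_add_iff (N + 2)).2 hsum.summable), ← ENNReal.tsum_mul_left]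
    refine ENNReal.tsum_le_tsum fun n => ?_
    rw [← ofReal_norm, ← ENNReal.ofReal_mul (by positivity)]
    refine ENNReal.ofReal_le_ofReal ?_
    rw [sq]
    gcongr
    exact heC _
  have hsplit : Q / 2 = (C / √t) * (Q / (2 * C) * √t) := by field_simp
  rw [hsplit, ENNReal.ofReal_mul (by positivity)] at htail'
  exact (ENNReal.mul_le_mul_iff_right (by simpa using by positivity) ENNReal.ofReal_ne_top).1 htail'

end DispersiveEstimate

/-! ### Chebyshev polynomials of `(a + b) / 2` with `b a = 1` -/

section Chebyshev

open Polynomial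

/-- Write `S_k` for the antidiagonal sum. Left multiplication by `a` gives all words of `S_{k+2}`
except `b^{k+2}`; left multiplication by `b` cancels one `a` in every word that contains one, giving
`S_k`, and turns `b^{k+1}` into the missing word. -/
theorem antidiagonal_sum_recurrence {R : Type*} [Ring R] {a b : R} (hba : b * a = 1) (k : ℕ) :
    (a + b) * ∑ ij ∈ Finset.HasAntidiagonal.antidiagonal (k + 1), a ^ ij.1 * b ^ ij.2 =
      (∑ ij ∈ Finset.HasAntidiagonal.antidiagonal (k + 2), a ^ ij.1 * b ^ ij.2) +
        ∑ ij ∈ Finset.HasAntidiagonal.antidiagonal k, a ^ ij.1 * b ^ ij.2 := by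
  have h : ∀ n : ℕ, (∑ ij ∈ Finset.HasAntidiagonal.antidiagonal (n + 1), a ^ ij.1 * b ^ ij.2) =
      b ^ (n + 1) + a * ∑ ij ∈ Finset.HasAntidiagonal.antidiagonal n, a ^ ij.1 * b ^ ij.2 := by
    intro n
    rw [Finset.Nat.sum_antidiagonal_succ, Finset.mul_sum]
    simp [pow_succ', mul_assoc]
  have h1 : b * ∑ ij ∈ Finset.HasAntidiagonal.antidiagonal (k + 1), a ^ ij.1 * b ^ ij.2 =
      b ^ (k + 2) + ∑ ij ∈ Finset.HasAntidiagonal.antidiagonal k, a ^ ij.1 * b ^ ij.2 := by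
    rw [h k, mul_add, ← pow_succ', ← mul_assoc, hba, one_mul]
  rw [add_mul, h1, h (k + 1)]
  abel

/-- The Chebyshev polynomials of the second kind evaluated at `(a + b) / 2`, where `b` is a left
inverse of `a`. -/
theorem aeval_chebyshev_U_of_mul_eq_one {R : Type*} [Ring R] [Algebra ℂ R] {a b M : R}
    (hba : b * a = 1) (hM : 2 * M = a + b) (k : ℕ) :
    aeval M (Chebyshev.U ℂ k) = ∑ ij ∈ Finset.HasAntidiagonal.antidiagonal k, a ^ ij.1 * b ^ ij.2 := by
  induction k using Nat.twoStepInduction with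
  | zero => simp
  | one =>
    simp only [Nat.cast_one, Chebyshev.U_one, map_mul, aeval_X, map_ofNat, hM]
    rw [Finset.Nat.sum_antidiagonal_succ]
    simp [add_comm]
  | more k ih1 ih2 =>
    push_cast at ih2 ⊢
    rw [Chebyshev.U_add_two, map_sub, map_mul, map_mul, map_ofNat, aeval_X, hM, ih1, ih2,
      antidiagonal_sum_recurrence hba, add_sub_cancel_right]

/-- The Chebyshev polynomials of the second kind span all polynomials. -/
theorem span_chebyshev_U :
    Submodule.span ℂ (Set.range fun k : ℕ => Chebyshev.U ℂ k) = ⊤ := by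
  set W := Submodule.span ℂ (Set.range fun k : ℕ => Chebyshev.U ℂ k) with hW
  have hU : ∀ k : ℕ, Chebyshev.U ℂ k ∈ W := fun k => Submodule.subset_span ⟨k, rfl⟩
  have hX : ∀ p ∈ W, X * p ∈ W := by
    intro p hp
    induction hp using Submodule.span_induction with
    | mem p hp =>
      obtain ⟨k, rfl⟩ := hp
      -- The three-term recurrence makes the span stable under multiplication by `X`; the case `k =
      -- 0` uses `U_{-1} = 0`.
      have h : X * Chebyshev.U ℂ (k : ℤ) =
          (1 / 2 : ℂ) • (Chebyshev.U ℂ ((k : ℤ) + 1) + Chebyshev.U ℂ ((k : ℤ) - 1)) := by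
        rw [Chebyshev.U_add_one, sub_add_cancel, mul_assoc, two_mul, ← two_smul ℂ, smul_smul]
        norm_num
      dsimp only
      rw [h]
      refine W.smul_mem _ (W.add_mem ?_ ?_)
      · exact_mod_cast hU (k + 1)
      · cases k with
        | zero => simp
        | succ k =>
          have := hU k
          push_cast
          rwa [add_sub_cancel_right]
    | zero => simp
    | add p r _ _ h1 h2 => rw [mul_add]; exact W.add_mem h1 h2
    | smul c p _ h => rw [mul_smul_comm]; exact W.smul_mem _ h
  have hpow : ∀ n : ℕ, (X : ℂ[X]) ^ n ∈ W := by
    intro n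
    induction n with
    | zero => simpa using hU 0
    | succ n ih => rw [pow_succ']; exact hX _ ih
  refine (Submodule.eq_top_iff').2 fun p => ?_
  rw [p.as_sum_range_C_mul_X_pow]
  refine W.sum_mem fun n _ => ?_
  rw [← smul_eq_C_mul]
  exact W.smul_mem _ (hpow n)

/-- Weierstrass approximation for complex-valued functions. -/
theorem exists_complex_polynomial_near {F : ℝ → ℂ} (hF : Continuous F) (R : ℝ) {ε : ℝ}
    (hε : 0 < ε) : ∃ p : ℂ[X], ∀ x ∈ Set.Icc (-R) R, ‖F x - p.eval (1 - (x : ℂ))‖ ≤ ε := by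
  have hG : Continuous fun u : ℝ => F (1 - u) := by fun_prop
  obtain ⟨p₁, h₁⟩ := exists_polynomial_near_of_continuousOn (-(R + 1)) (R + 1)
    (fun u => (F (1 - u)).re) (Complex.continuous_re.comp hG).continuousOn (ε / 2) (by linarith)
  obtain ⟨p₂, h₂⟩ := exists_polynomial_near_of_continuousOn (-(R + 1)) (R + 1)
    (fun u => (F (1 - u)).im) (Complex.continuous_im.comp hG).continuousOn (ε / 2) (by linarith)
  refine ⟨p₁.map Complex.ofRealHom + C Complex.I * p₂.map Complex.ofRealHom, fun x hx => ?_⟩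
  have hmem : 1 - x ∈ Set.Icc (-(R + 1)) (R + 1) := ⟨by linarith [hx.2], by linarith [hx.1]⟩
  have e₁ := h₁ _ hmem
  have e₂ := h₂ _ hmem
  simp only [sub_sub_cancel] at e₁ e₂
  have hev : ∀ p : ℝ[X], (p.map Complex.ofRealHom).eval (1 - (x : ℂ)) =
      ((p.eval (1 - x) : ℝ) : ℂ) := by
    intro p
    have : (1 - (x : ℂ)) = Complex.ofRealHom (1 - x) := by simp
    rw [this, eval_map_apply]
    rfl
  rw [eval_add, eval_mul, eval_C, hev, hev]
  refine (Complex.norm_le_abs_re_add_abs_im _).trans ?_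
  simp only [Complex.sub_re, Complex.add_re, Complex.ofReal_re, Complex.mul_re, Complex.I_re,
    Complex.ofReal_im, Complex.I_im, Complex.sub_im, Complex.add_im, Complex.mul_im]
  rw [abs_sub_comm] at e₁ e₂
  have a1 : (F x).re - (eval (1 - x) p₁ + (0 * eval (1 - x) p₂ - 1 * 0)) =
    (F x).re - eval (1 - x) p₁ := by ring
  have a2 : (F x).im - (0 + (0 * 0 + 1 * eval (1 - x) p₂)) = (F x).im - eval (1 - x) p₂ := by ring
  rw [a1, a2]
  linarith

end Chebyshev

/-! ### Ascending paths and where they meet -/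

namespace InfinityRootedTree

variable {V : Type*} (T : InfinityRootedTree V)

theorem level_iterate_pred (n : ℕ) (x : V) : T.level (T.pred^[n] x) = T.level x + n := by
  induction n with
  | zero => simp
  | succ n ih =>
    rw [Function.iterate_succ_apply', (T.pred_spec _).2, ih]
    push_cast
    ring

theorem level_le_of_walk {x y : V} (p : T.graph.Walk x y) : T.level y ≤ T.level x + p.length := by
  induction p with
  | nil => simp
  | cons h p ih =>
    have := T.level_adj h
    rw [SimpleGraph.Walk.length_cons]
    push_cast
    omega

/-- Each edge changes the level by one, so a walk whose level gain equals its length must go up at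
every step. -/
theorem iterate_pred_of_walk {x y : V} (p : T.graph.Walk x y)
    (h : T.level y = T.level x + p.length) : T.pred^[p.length] x = y := by
  induction p with
  | nil => simp
  | @cons u v w hadj p ih =>
    have h1 := T.level_adj hadj
    have h2 := T.level_le_of_walk p
    rw [SimpleGraph.Walk.length_cons] at h ⊢
    push_cast at h
    have hv : T.level v = T.level u + 1 := by omega
    rw [Function.iterate_succ_apply, (T.existsUnique_pred u).unique (T.pred_spec u) ⟨hadj, hv⟩]
    exact ih (by omega)

theorem iterate_pred_of_below {x y : V} (h : T.Below x y) :
    T.pred^[T.graph.dist x y] x = y := by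
  obtain ⟨p, hp⟩ := T.isTree.connected.exists_walk_length_eq_dist x y
  rw [← hp]
  refine T.iterate_pred_of_walk p ?_
  unfold Below at h
  rw [hp]
  omega

theorem exists_walk_iterate_pred (n : ℕ) (x : V) :
    ∃ p : T.graph.Walk x (T.pred^[n] x), p.length = n := by
  induction n generalizing x with
  | zero => exact ⟨.nil, rfl⟩
  | succ n ih =>
    obtain ⟨p, hp⟩ := ih (T.pred x)
    rw [Function.iterate_succ_apply]
    exact ⟨.cons (T.pred_spec x).1 p, by rw [SimpleGraph.Walk.length_cons, hp]⟩

theorem dist_iterate_pred (n : ℕ) (x : V) : T.graph.dist x (T.pred^[n] x) = n := by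
  obtain ⟨p, hp⟩ := T.exists_walk_iterate_pred n x
  obtain ⟨r, hr⟩ := T.isTree.connected.exists_walk_length_eq_dist x (T.pred^[n] x)
  have h1 := SimpleGraph.dist_le p
  have h2 := T.level_le_of_walk r
  rw [T.level_iterate_pred] at h2
  omega

theorem below_iterate_pred (n : ℕ) (x : V) : T.Below x (T.pred^[n] x) := by
  rw [Below, T.dist_iterate_pred, T.level_iterate_pred]
  ring

/-- The ascending paths from `y` and `x` first meet after `i` and `j` steps respectively. -/
def MeetsAt (y x : V) (i j : ℕ) : Prop :=
  ∀ a b, T.pred^[a] y = T.pred^[b] x ↔ ∃ l, a = i + l ∧ b = j + l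

/-- Levels force any two meetings to differ by the same number of steps along both paths. A meeting
before `a + 1` would persist up to step `a`, contradicting `hne`. -/
theorem meetsAt_succ {y x : V} {a b : ℕ} (h : T.pred^[a + 1] y = T.pred^[b + 1] x)
    (hne : T.pred^[a] y ≠ T.pred^[b] x) : T.MeetsAt y x (a + 1) (b + 1) := by
  have hlev := congrArg T.level h
  rw [T.level_iterate_pred, T.level_iterate_pred] at hlev
  intro a' b'
  constructor
  · intro h'
    have hlev' := congrArg T.level h'
    rw [T.level_iterate_pred, T.level_iterate_pred] at hlev'
    by_cases hle : a' ≤ a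
    · exfalso
      apply hne
      obtain ⟨k, rfl⟩ := Nat.exists_eq_add_of_le hle
      have hb : b = b' + k := by push_cast at hlev; omega
      rw [hb, add_comm a', add_comm b', Function.iterate_add_apply, Function.iterate_add_apply, h']
    · exact ⟨a' - (a + 1), by omega, by push_cast at hlev; omega⟩
  · rintro ⟨l, rfl, rfl⟩
    rw [add_comm (a + 1), add_comm (b + 1), Function.iterate_add_apply, h,
      ← Function.iterate_add_apply]

theorem MeetsAt.pred {y x : V} {i j : ℕ} (h : T.MeetsAt y x i (j + 1)) :
    T.MeetsAt y (T.pred x) i j := by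
  intro a b
  rw [← Function.iterate_succ_apply, h a b.succ]
  exact exists_congr fun l => by omega

end InfinityRootedTree

/-! ### Point masses, the shift, and the functional calculus -/

namespace FlowTree

variable {V : Type*}

theorem IsCanonical.m_iterate_pred {T : FlowTree V} {q : ℕ} (hT : T.IsCanonical q) (hq : 2 ≤ q)
    (n : ℕ) (x : V) : T.m (T.pred^[n] x) = (q : ℝ) ^ n * T.m x := by
  have hq0 : (q : ℝ) ≠ 0 := by positivity
  rw [hT.2, hT.2, T.level_iterate_pred, zpow_add₀ hq0, zpow_natCast, mul_comm]

variable [MeasurableSpace V] [DiscreteMeasurableSpace V] (T : FlowTree V)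

theorem measure_singleton (x : V) : T.measure {x} = ENNReal.ofReal (T.m x) := by
  rw [measure_apply, tsum_eq_single x]
  · simp
  · intro y hy
    simp [hy]

theorem measure_singleton_ne_top (x : V) : T.measure {x} ≠ ⊤ := by
  rw [T.measure_singleton]
  exact ENNReal.ofReal_ne_top

theorem measureReal_singleton (x : V) : T.measure.real {x} = T.m x := by
  rw [Measure.real, T.measure_singleton, ENNReal.toReal_ofReal (T.m_pos x).le]

/-- Every vertex has positive mass, so classes in `L²(m)` are genuine functions. -/
theorem ae_iff_forall {P : V → Prop} : (∀ᵐ y ∂T.measure, P y) ↔ ∀ y, P y := by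
  refine ⟨fun h y => ?_, fun h => Eventually.of_forall h⟩
  by_contra hy
  have h0 : T.measure {y} = 0 := measure_mono_null (by simpa using hy) (ae_iff.1 h)
  rw [T.measure_singleton, ENNReal.ofReal_eq_zero] at h0
  exact absurd (T.m_pos y) (not_lt.2 h0)

theorem eq_of_ae_eq {E : Type*} {f g : V → E} (h : f =ᵐ[T.measure] g) : f = g :=
  funext ((T.ae_iff_forall).1 h)

theorem measure_preimage_iterate_pred (n : ℕ) (z : V) :
    T.measure (T.pred^[n] ⁻¹' {z}) = ENNReal.ofReal (T.m z) := by
  rw [(T.measurePreserving_pred.iterate n).measure_preimage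
    (MeasurableSet.of_discrete).nullMeasurableSet, T.measure_singleton]

/-- The unit point mass at `x`, as an element of `L²(m)`. -/
def pointMass (x : V) : Lp ℂ 2 T.measure :=
  (T.m x : ℂ)⁻¹ • indicatorConstLp 2 (MeasurableSet.of_discrete (s := {x}))
    (T.measure_singleton_ne_top x) (1 : ℂ)

theorem coe_pointMass (x : V) :
    (T.pointMass x : V → ℂ) = Set.indicator {x} fun _ => (T.m x : ℂ)⁻¹ := by
  apply T.eq_of_ae_eq
  unfold pointMass
  filter_upwards [Lp.coeFn_smul (T.m x : ℂ)⁻¹ (indicatorConstLp 2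
    (MeasurableSet.of_discrete (s := {x})) (T.measure_singleton_ne_top x) (1 : ℂ)),
    indicatorConstLp_coeFn (p := 2) (hs := MeasurableSet.of_discrete (s := {x}))
      (hμs := T.measure_singleton_ne_top x) (c := (1 : ℂ))] with y h1 h2
  rw [h1, Pi.smul_apply, h2]
  by_cases hy : y ∈ ({x} : Set V) <;> simp [hy]

theorem inner_pointMass (x : V) (h : Lp ℂ 2 T.measure) : inner ℂ (T.pointMass x) h = h x := by
  unfold pointMass
  rw [inner_smul_left, L2.inner_indicatorConstLp_one, integral_singleton, T.measureReal_singleton]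
  have hm : (T.m x : ℂ) ≠ 0 := by exact_mod_cast (T.m_pos x).ne'
  rw [Complex.real_smul, map_inv₀, Complex.conj_ofReal, ← mul_assoc, inv_mul_cancel₀ hm, one_mul]

theorem shift_apply (h : Lp ℂ 2 T.measure) (y : V) : T.shift h y = h (T.pred y) :=
  congrFun (T.eq_of_ae_eq (Lp.coeFn_compMeasurePreserving h T.measurePreserving_pred)) y

open ContinuousLinearMap in
-- With the normalization by `m(x)⁻¹`, pairing with a point mass is evaluation, so `Σ*` just moves
-- the mass one step up.
theorem adjoint_shift_pointMass (x : V) :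
    adjoint T.shift (T.pointMass x) = T.pointMass (T.pred x) := by
  refine ext_inner_right ℂ fun h => ?_
  rw [adjoint_inner_left, T.inner_pointMass, T.inner_pointMass, T.shift_apply]

theorem adjoint_shift_pow_pointMass (n : ℕ) (x : V) :
    (ContinuousLinearMap.adjoint T.shift ^ n) (T.pointMass x) = T.pointMass (T.pred^[n] x) := by
  induction n with
  | zero => simp
  | succ n ih =>
    rw [pow_succ', mul_apply_eq_comp, ih, T.adjoint_shift_pointMass,
      Function.iterate_succ_apply']

theorem adjoint_shift_mul_shift : ContinuousLinearMap.adjoint T.shift * T.shift = 1 :=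
  T.shift.norm_map_iff_adjoint_comp_self.1 fun h =>
    (Lp.compMeasurePreservingₗᵢ ℂ T.pred T.measurePreserving_pred).norm_map h

/-- Expansion of `(1 - Σ)*(1 - Σ)`, where `Σ*Σ = 1` because the shift is an isometry. -/
theorem two_mul_one_sub_laplacian :
    2 * (1 - T.laplacian) = T.shift + ContinuousLinearMap.adjoint T.shift := by
  have hg : T.gradient = 1 - T.shift := rfl
  have hl : T.laplacian =
      (1 / 2 : ℂ) • (ContinuousLinearMap.adjoint T.gradient * T.gradient) := rfl
  have hone : ContinuousLinearMap.adjoint (1 : Lp ℂ 2 T.measure →L[ℂ] Lp ℂ 2 T.measure) = 1 :=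
    ContinuousLinearMap.adjoint_id
  have h2 : (2 : Lp ℂ 2 T.measure →L[ℂ] Lp ℂ 2 T.measure) * T.laplacian =
      ContinuousLinearMap.adjoint T.gradient * T.gradient := by
    rw [hl, mul_smul_comm, two_mul, ← two_smul ℂ, smul_smul]
    norm_num
  rw [mul_sub, h2, hg, map_sub, hone, mul_one, sub_mul, mul_sub, mul_sub,
    T.adjoint_shift_mul_shift]
  simp only [one_mul, mul_one]
  have h3 : (2 : Lp ℂ 2 T.measure →L[ℂ] Lp ℂ 2 T.measure) = 1 + 1 := one_add_one_eq_two.symm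
  rw [h3]
  abel

theorem isSelfAdjoint_laplacian : IsSelfAdjoint T.laplacian := by
  have hl : T.laplacian = (1 / 2 : ℂ) • (star T.gradient * T.gradient) := rfl
  rw [hl]
  refine IsSelfAdjoint.smul ?_ (IsSelfAdjoint.star_mul_self _)
  simp [IsSelfAdjoint]

theorem abs_re_le_of_mem_spectrum {z : ℂ} (hz : z ∈ spectrum ℂ T.laplacian) :
    z.re ∈ Set.Icc (-‖T.laplacian‖) ‖T.laplacian‖ := by
  have hne : Nontrivial (Lp ℂ 2 T.measure →L[ℂ] Lp ℂ 2 T.measure) := by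
    by_contra h
    rw [not_nontrivial_iff_subsingleton] at h
    simp [spectrum.of_subsingleton] at hz
  exact abs_le.1 ((Complex.abs_re_le_norm z).trans (spectrum.norm_le_norm_of_mem hz))

theorem multiplier_sub {F G : ℝ → ℂ} (hF : Continuous F) (hG : Continuous G) :
    T.multiplier (fun x => F x - G x) = T.multiplier F - T.multiplier G :=
  cfc_sub _ _ T.laplacian (hF.comp Complex.continuous_re).continuousOn
    (hG.comp Complex.continuous_re).continuousOn

theorem norm_multiplier_le {F : ℝ → ℂ} {M : ℝ} (hM : 0 ≤ M)
    (h : ∀ x ∈ Set.Icc (-‖T.laplacian‖) ‖T.laplacian‖, ‖F x‖ ≤ M) : ‖T.multiplier F‖ ≤ M :=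
  norm_cfc_le hM fun _ hz => h _ (T.abs_re_le_of_mem_spectrum hz)

open Polynomial in
-- The multiplier evaluates `F` at the real part; this agrees with the polynomial itself because the
-- spectrum is real.
theorem multiplier_polynomial (p : ℂ[X]) :
    T.multiplier (fun x : ℝ => p.eval (1 - (x : ℂ))) = aeval (1 - T.laplacian) p := by
  have hn : IsStarNormal T.laplacian := T.isSelfAdjoint_laplacian.isStarNormal
  have h1 : T.multiplier (fun x : ℝ => p.eval (1 - (x : ℂ))) =
      cfc (p.comp (1 - X)).eval T.laplacian := by
    refine cfc_congr fun z hz => ?_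
    have hz' := T.isSelfAdjoint_laplacian.mem_spectrum_eq_re hz
    simp [eval_comp, ← hz']
  rw [h1, cfc_polynomial _ _ hn, aeval_comp]
  simp

theorem inner_shift_pow_adjoint_pow (x y : V) (a b : ℕ) :
    inner ℂ (T.pointMass y)
      ((T.shift ^ a * ContinuousLinearMap.adjoint T.shift ^ b) (T.pointMass x)) =
      T.pointMass (T.pred^[b] x) (T.pred^[a] y) := by
  have h : T.shift ^ a =
      ContinuousLinearMap.adjoint (ContinuousLinearMap.adjoint T.shift ^ a) := by
    change T.shift ^ a = star (star T.shift ^ a)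
    rw [star_pow, star_star]
  rw [mul_apply_eq_comp, T.adjoint_shift_pow_pointMass, h,
    ContinuousLinearMap.adjoint_inner_right, T.adjoint_shift_pow_pointMass, T.inner_pointMass]

end FlowTree

/-! ### Inversion of the geometric sums and counting of pairs -/

section GeometricSums

/-- The sum `∑ l, q^{-l} d(n + 2l)`. -/
def geomSum (q : ℕ) (d : ℤ → ℂ) (n : ℕ) : ℂ :=
  ∑' l : ℕ, ((q : ℂ)⁻¹) ^ l * d ((n + 2 * l : ℕ) : ℤ)

theorem norm_inv_natCast_le {q : ℕ} (hq : 2 ≤ q) : ‖(q : ℂ)⁻¹‖ ≤ 1 / 2 := by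
  rw [norm_inv, Complex.norm_natCast, one_div]
  have : (2 : ℝ) ≤ q := by exact_mod_cast hq
  gcongr

theorem norm_geom_term_le {q : ℕ} (hq : 2 ≤ q) {d : ℤ → ℂ} {M : ℝ} (hd : ∀ n, ‖d n‖ ≤ M) (n l : ℕ) :
    ‖((q : ℂ)⁻¹) ^ l * d ((n + 2 * l : ℕ) : ℤ)‖ ≤ (1 / 2 : ℝ) ^ l * M := by
  rw [norm_mul, norm_pow]
  have := norm_inv_natCast_le hq
  gcongr
  exact hd _

theorem summable_geomSum {q : ℕ} (hq : 2 ≤ q) {d : ℤ → ℂ} {M : ℝ} (hd : ∀ n, ‖d n‖ ≤ M) (n : ℕ) :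
    Summable fun l : ℕ => ((q : ℂ)⁻¹) ^ l * d ((n + 2 * l : ℕ) : ℤ) :=
  Summable.of_norm_bounded (summable_geometric_two.mul_right M) (norm_geom_term_le hq hd n)

theorem norm_geomSum_le {q : ℕ} (hq : 2 ≤ q) {d : ℤ → ℂ} {M : ℝ} (hd : ∀ n, ‖d n‖ ≤ M) (n : ℕ) :
    ‖geomSum q d n‖ ≤ 2 * M :=
  tsum_of_norm_bounded (hasSum_geometric_two.mul_right M) (norm_geom_term_le hq hd n)

theorem geomSum_sub {q : ℕ} (hq : 2 ≤ q) {d d' : ℤ → ℂ} {M M' : ℝ} (hd : ∀ n, ‖d n‖ ≤ M)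
    (hd' : ∀ n, ‖d' n‖ ≤ M') (n : ℕ) :
    geomSum q (fun k => d k - d' k) n = geomSum q d n - geomSum q d' n := by
  unfold geomSum
  rw [← (summable_geomSum hq hd n).tsum_sub (summable_geomSum hq hd' n)]
  exact tsum_congr fun l => mul_sub _ _ _

theorem geomSum_add {q : ℕ} (hq : 2 ≤ q) {d d' : ℤ → ℂ} {M M' : ℝ} (hd : ∀ n, ‖d n‖ ≤ M)
    (hd' : ∀ n, ‖d' n‖ ≤ M') (n : ℕ) :
    geomSum q (fun k => d k + d' k) n = geomSum q d n + geomSum q d' n := by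
  unfold geomSum
  rw [← (summable_geomSum hq hd n).tsum_add (summable_geomSum hq hd' n)]
  exact tsum_congr fun l => mul_add _ _ _

theorem geomSum_const_mul (q : ℕ) (c : ℂ) (d : ℤ → ℂ) (n : ℕ) :
    geomSum q (fun k => c * d k) n = c * geomSum q d n := by
  unfold geomSum
  rw [← tsum_mul_left]
  exact tsum_congr fun l => mul_left_comm _ _ _

theorem geomSum_eq_add {q : ℕ} (hq : 2 ≤ q) {d : ℤ → ℂ} {M : ℝ} (hd : ∀ n, ‖d n‖ ≤ M) (n : ℕ) :
    geomSum q d n = d n + (q : ℂ)⁻¹ * geomSum q d (n + 2) := by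
  unfold geomSum
  rw [(summable_geomSum hq hd n).tsum_eq_zero_add, ← tsum_mul_left]
  congr 1
  · simp
  · refine tsum_congr fun l => ?_
    rw [pow_succ', mul_assoc]
    congr 4
    ring

/-- The sum is inverted by `d(n) = S(n) - q⁻¹ S(n + 2)`, where `S = geomSum q d`; the factor 2
bounds `1 + q⁻¹`. -/
theorem tsum_enorm_le_tsum_geomSum {q : ℕ} (hq : 2 ≤ q) {d : ℤ → ℂ} {M : ℝ}
    (hd : ∀ n, ‖d n‖ ≤ M) (N : ℕ) :
    ∑' n : ℕ, ‖d ((n + N : ℕ) : ℤ)‖ₑ ≤ 2 * ∑' n : ℕ, ‖geomSum q d (n + N)‖ₑ := by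
  have h1 : ∀ n : ℕ, ‖d ((n + N : ℕ) : ℤ)‖ₑ ≤
      ‖geomSum q d (n + N)‖ₑ + ‖geomSum q d ((n + 2) + N)‖ₑ := by
    intro n
    have h := geomSum_eq_add hq hd (n + N)
    have h2 : d ((n + N : ℕ) : ℤ) =
        geomSum q d (n + N) - (q : ℂ)⁻¹ * geomSum q d ((n + 2) + N) := by
      rw [h, show n + 2 + N = n + N + 2 by ring]; ring
    rw [enorm_eq_nnnorm, enorm_eq_nnnorm, enorm_eq_nnnorm]
    norm_cast
    rw [← NNReal.coe_le_coe]
    push_cast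
    have h3 := norm_inv_natCast_le hq
    calc ‖d ((n + N : ℕ) : ℤ)‖ ≤ ‖geomSum q d (n + N)‖ + ‖(q : ℂ)⁻¹ * geomSum q d ((n + 2) + N)‖ := by
          rw [h2]; exact norm_sub_le _ _
      _ ≤ _ := by
          rw [norm_mul]
          have := mul_le_of_le_one_left (norm_nonneg (geomSum q d ((n + 2) + N)))
            (h3.trans (by norm_num))
          linarith
  calc _ ≤ ∑' n : ℕ, (‖geomSum q d (n + N)‖ₑ + ‖geomSum q d ((n + 2) + N)‖ₑ) :=
        ENNReal.tsum_le_tsum h1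
    _ = _ := ENNReal.tsum_add
    _ ≤ ∑' n : ℕ, ‖geomSum q d (n + N)‖ₑ + ∑' n : ℕ, ‖geomSum q d (n + N)‖ₑ := by
        exact add_le_add le_rfl (ENNReal.tsum_comp_le_tsum_of_injective (add_left_injective 2)
          (fun n => ‖geomSum q d (n + N)‖ₑ))
    _ = _ := (two_mul _).symm

/-- For each of the `N` values `a < N`, the indices `a + b + 2` run through everything from `N + 2`
on. This is the source of the extra factor `t` in the lower bound. -/
theorem nsmul_tsum_le_tsum_prod (f : ℕ → ℝ≥0∞) (N : ℕ) :
    (N : ℝ≥0∞) * ∑' n : ℕ, f (n + (N + 2)) ≤ ∑' p : ℕ × ℕ, f (p.1 + p.2 + 2) := by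
  rw [ENNReal.tsum_prod (f := fun a b => f (a + b + 2))]
  refine le_trans ?_ (ENNReal.sum_le_tsum (Finset.range N))
  have h : ∀ a ∈ Finset.range N, ∑' n : ℕ, f (n + (N + 2)) ≤ ∑' b : ℕ, f (a + b + 2) := by
    intro a ha
    have ha' := Finset.mem_range.1 ha
    have h2 := ENNReal.tsum_comp_le_tsum_of_injective (add_left_injective (N - a))
      (fun b => f (a + b + 2))
    refine le_trans (le_of_eq (tsum_congr fun n => ?_)) h2
    congr 1
    omega
  calc _ = ∑ _a ∈ Finset.range N, ∑' n : ℕ, f (n + (N + 2)) := by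
        rw [Finset.sum_const, Finset.card_range, nsmul_eq_mul]
    _ ≤ _ := Finset.sum_le_sum h

end GeometricSums

/-! ### Partition by first meeting steps -/

namespace InfinityRootedTree

variable {V : Type*} (T : InfinityRootedTree V)

/-- The vertices whose ascending path meets the one of `x` first after `a + 1` and `b + 1` steps. -/
def meetingSet (x : V) (p : ℕ × ℕ) : Set V :=
  {y | T.pred^[p.1 + 1] y = T.pred^[p.2 + 1] x ∧ T.pred^[p.1] y ≠ T.pred^[p.2] x}

theorem meetingSet_disjoint (x : V) : Pairwise (Function.onFun Disjoint (T.meetingSet x)) := by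
  rintro ⟨a, b⟩ ⟨a', b'⟩ hne
  rw [Function.onFun, Set.disjoint_left]
  rintro y ⟨h1, h2⟩ ⟨h3, h4⟩
  obtain ⟨l, hl1, hl2⟩ := (T.meetsAt_succ h1 h2 _ _).1 h3
  obtain ⟨l', hl1', hl2'⟩ := (T.meetsAt_succ h3 h4 _ _).1 h1
  dsimp only at hl1 hl2 hl1' hl2'
  apply hne
  ext <;> dsimp only <;> omega

end InfinityRootedTree

/-! ### The kernel of a multiplier, atoms, and the `L¹` lower bound -/

namespace FlowTree

variable {V : Type*} [MeasurableSpace V]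

theorem IsAtom.hardyNorm_le_one {T : FlowTree V} {a : V → ℂ} (ha : T.IsAtom a) :
    T.hardyNorm a ≤ 1 := by
  unfold hardyNorm
  refine iInf_le_of_le (fun j => if j = 0 then 1 else 0) (iInf_le_of_le (fun _ => a)
    (iInf_le_of_le (fun _ => ha) (iInf_le_of_le (fun x => ?_) ?_)))
  · convert hasSum_single (f := fun j : ℕ => (if j = 0 then 1 else 0) * a x) 0 ?_ using 1
    · simp
    · intro j hj
      simp [hj]
  · rw [tsum_eq_single 0]
    · simp
    · intro j hj
      simp [hj]

variable [DiscreteMeasurableSpace V] (T : FlowTree V)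

theorem pointMass_apply (x y : V) [Decidable (y = x)] :
    T.pointMass x y = if y = x then (T.m x : ℂ)⁻¹ else 0 := by
  rw [T.coe_pointMass]
  split_ifs with h <;> simp [h]

open Polynomial in
/-- The integral kernel of the Chebyshev polynomials of `1 - 𝓛`. -/
theorem inner_aeval_chebyshev {T : FlowTree V} {q : ℕ} (hT : T.IsCanonical q) (hq : 2 ≤ q)
    {x y : V} {i j : ℕ} (h : T.MeetsAt y x i j) (k : ℕ) :
    inner ℂ (T.pointMass y) (aeval (1 - T.laplacian) (Chebyshev.U ℂ k) (T.pointMass x)) =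
      (T.m (T.pred^[j] x) : ℂ)⁻¹ * ∑' l : ℕ, ((q : ℂ)⁻¹) ^ l *
        (if i + j + 1 + 2 * l = k + 1 then 1 else 0) := by
  classical
  rw [aeval_chebyshev_U_of_mul_eq_one T.adjoint_shift_mul_shift T.two_mul_one_sub_laplacian,
    _root_.sum_apply, inner_sum]
  simp_rw [T.inner_shift_pow_adjoint_pow, T.pointMass_apply]
  -- Among the words of length `k`, only `(a, b) = (i + l, j + l)` with `i + j + 2l = k`
  -- contributes, with weight `m(p^{j+l} x)⁻¹ = q^{-l} m(p^j x)⁻¹`.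
  by_cases hk : ∃ l, i + j + 2 * l = k
  · obtain ⟨l, rfl⟩ := hk
    rw [Finset.sum_eq_single (i + l, j + l), tsum_eq_single l]
    · rw [if_pos ((h _ _).2 ⟨l, rfl, rfl⟩), if_pos (by ring), mul_one, add_comm j,
        Function.iterate_add_apply, hT.m_iterate_pred hq]
      push_cast
      rw [mul_inv, inv_pow, mul_comm]
    · intro l' hl'
      rw [if_neg (by omega), mul_zero]
    · rintro ⟨a, b⟩ hab hne
      rw [Finset.HasAntidiagonal.mem_antidiagonal] at hab
      refine if_neg fun hm => hne ?_
      obtain ⟨l', rfl, rfl⟩ := (h a b).1 hm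
      dsimp only at hab
      have : l' = l := by omega
      rw [this]
    · intro hn
      exact absurd (Finset.HasAntidiagonal.mem_antidiagonal.2 (by ring)) hn
  · rw [Finset.sum_eq_zero, tsum_congr (g := fun _ => 0), tsum_zero, mul_zero]
    · intro l
      rw [if_neg (fun hl => hk ⟨l, by omega⟩), mul_zero]
    · rintro ⟨a, b⟩ hab
      rw [Finset.HasAntidiagonal.mem_antidiagonal] at hab
      refine if_neg fun hm => hk ?_
      obtain ⟨l, rfl, rfl⟩ := (h a b).1 hm
      exact ⟨l, by dsimp only at hab; omega⟩

open Polynomial in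
-- Both sides are linear in `p`, and the Chebyshev polynomials span; on `U_k` the sine coefficients
-- reduce to a Kronecker delta by orthogonality.
theorem inner_multiplier_polynomial {T : FlowTree V} {q : ℕ} (hT : T.IsCanonical q) (hq : 2 ≤ q)
    {x y : V} {i j : ℕ} (h : T.MeetsAt y x i j) (p : ℂ[X]) :
    inner ℂ (T.pointMass y) (T.multiplier (fun x : ℝ => p.eval (1 - (x : ℂ))) (T.pointMass x)) =
      (T.m (T.pred^[j] x) : ℂ)⁻¹ *
        geomSum q (sineCoeff fun x : ℝ => p.eval (1 - (x : ℂ))) (i + j + 1) := by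
  have hc : ∀ p : ℂ[X], Continuous fun x : ℝ => p.eval (1 - (x : ℂ)) := fun p =>
    p.continuous.comp (by fun_prop)
  rw [T.multiplier_polynomial]
  have hp : p ∈ Submodule.span ℂ (Set.range fun k : ℕ => Chebyshev.U ℂ k) := by
    rw [span_chebyshev_U]; trivial
  induction hp using Submodule.span_induction with
  | mem p hp =>
    obtain ⟨k, rfl⟩ := hp
    dsimp only
    rw [inner_aeval_chebyshev hT hq h, geomSum]
    congr 1
    refine tsum_congr fun l => ?_
    rw [sineCoeff_chebyshev _ _ (by omega)]
  | zero =>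
    have : sineCoeff (fun x : ℝ => (0 : ℂ[X]).eval (1 - (x : ℂ))) = 0 := by
      ext n; simp [sineCoeff]
    rw [this]
    simp [geomSum]
  | add p r _ _ h1 h2 =>
    have : sineCoeff (fun x : ℝ => (p + r).eval (1 - (x : ℂ))) =
        fun n => sineCoeff (fun x : ℝ => p.eval (1 - (x : ℂ))) n +
          sineCoeff (fun x : ℝ => r.eval (1 - (x : ℂ))) n := by
      ext n
      rw [← sineCoeff_add (hc p) (hc r)]
      simp only [eval_add]
    obtain ⟨M, hM⟩ := exists_norm_sineCoeff_le (hc p)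
    obtain ⟨M', hM'⟩ := exists_norm_sineCoeff_le (hc r)
    rw [map_add, _root_.add_apply, inner_add_right, h1, h2, this,
      geomSum_add hq hM hM']
    ring
  | smul c p _ h1 =>
    have : sineCoeff (fun x : ℝ => (c • p).eval (1 - (x : ℂ))) =
        fun n => c * sineCoeff (fun x : ℝ => p.eval (1 - (x : ℂ))) n := by
      ext n
      rw [← sineCoeff_const_mul]
      simp only [eval_smul, smul_eq_mul]
    rw [map_smul, _root_.smul_apply, inner_smul_right, h1, this, geomSum_const_mul]
    ring

/-- The integral kernel of a spectral multiplier of the flow Laplacian. -/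
theorem inner_multiplier_pointMass {T : FlowTree V} {q : ℕ} (hT : T.IsCanonical q) (hq : 2 ≤ q)
    {F : ℝ → ℂ} (hF : Continuous F) {x y : V} {i j : ℕ} (h : T.MeetsAt y x i j) :
    inner ℂ (T.pointMass y) (T.multiplier F (T.pointMass x)) =
      (T.m (T.pred^[j] x) : ℂ)⁻¹ * geomSum q (sineCoeff F) (i + j + 1) := by
  set z : ℂ := (T.m (T.pred^[j] x) : ℂ)⁻¹ with hz
  set K : ℝ := ‖T.pointMass y‖ * ‖T.pointMass x‖ + ‖z‖ * 4 with hK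
  have hK0 : 0 ≤ K := by positivity
  rw [← sub_eq_zero, ← norm_le_zero_iff]
  refine le_of_forall_pos_le_add fun ε hε => ?_
  set η := ε / (K + 1) with hη
  have hη0 : 0 < η := by positivity
  -- The approximation must be uniform both on `[0, 2]`, which controls the sine coefficients, and
  -- on an interval containing the spectrum, which controls the operator.
  obtain ⟨p, hp⟩ := exists_complex_polynomial_near hF (max 2 ‖T.laplacian‖) hη0
  set G : ℝ → ℂ := fun x : ℝ => p.eval (1 - (x : ℂ)) with hG
  have hGc : Continuous G := p.continuous.comp (by fun_prop)
  have h1 : ‖T.multiplier F - T.multiplier G‖ ≤ η := by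
    rw [← T.multiplier_sub hF hGc]
    refine T.norm_multiplier_le hη0.le fun u hu => hp u ⟨?_, ?_⟩
    · linarith [hu.1, le_max_right 2 ‖T.laplacian‖]
    · exact hu.2.trans (le_max_right _ _)
  have h2 : ∀ n, ‖sineCoeff F n - sineCoeff G n‖ ≤ 2 * η := by
    intro n
    rw [← sineCoeff_sub hF hGc]
    refine norm_sineCoeff_le (fun u hu => hp u ⟨?_, hu.2.trans (le_max_left _ _)⟩) n
    linarith [hu.1, le_max_left 2 ‖T.laplacian‖]
  obtain ⟨M, hM⟩ := exists_norm_sineCoeff_le hF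
  obtain ⟨M', hM'⟩ := exists_norm_sineCoeff_le hGc
  have h3 := geomSum_sub hq hM hM' (i + j + 1)
  have h4 := norm_geomSum_le hq h2 (i + j + 1)
  have h5 := inner_multiplier_polynomial hT hq h p
  rw [← hz, ← hG] at h5
  have h6 : inner ℂ (T.pointMass y) (T.multiplier F (T.pointMass x)) -
      z * geomSum q (sineCoeff F) (i + j + 1) =
      inner ℂ (T.pointMass y) ((T.multiplier F - T.multiplier G) (T.pointMass x)) -
        z * geomSum q (fun k => sineCoeff F k - sineCoeff G k) (i + j + 1) := by
    rw [h3, _root_.sub_apply, inner_sub_right, h5]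
    ring
  rw [h6, zero_add]
  calc _ ≤ ‖inner ℂ (T.pointMass y) ((T.multiplier F - T.multiplier G) (T.pointMass x))‖ +
        ‖z * geomSum q (fun k => sineCoeff F k - sineCoeff G k) (i + j + 1)‖ := norm_sub_le _ _
    _ ≤ ‖T.pointMass y‖ * (η * ‖T.pointMass x‖) + ‖z‖ * (2 * (2 * η)) := by
        rw [norm_mul]
        gcongr
        refine (norm_inner_le_norm _ _).trans ?_
        gcongr
        exact ContinuousLinearMap.le_of_opNorm_le _ h1 _
    _ = K * η := by rw [hK]; ring
    _ ≤ (K + 1) * η := by gcongr; linarith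
    _ = ε := by rw [hη]; field_simp

/-- By the flow property, the vertices `p.1 + 1` levels below the meeting vertex have its total
mass; those lying below the child on the path from `x` take a fraction `1 / q ≤ 1 / 2`. -/
theorem le_measure_meetingSet {T : FlowTree V} {q : ℕ} (hT : T.IsCanonical q) (hq : 2 ≤ q) (x : V)
    (p : ℕ × ℕ) : ENNReal.ofReal (T.m (T.pred^[p.2 + 1] x) / 2) ≤ T.measure (T.meetingSet x p) := by
  have hset : T.meetingSet x p =
      (T.pred^[p.1 + 1] ⁻¹' {T.pred^[p.2 + 1] x}) \ (T.pred^[p.1] ⁻¹' {T.pred^[p.2] x}) := rfl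
  rw [hset]
  refine le_trans ?_ le_measure_sdiff
  rw [T.measure_preimage_iterate_pred, T.measure_preimage_iterate_pred,
    ← ENNReal.ofReal_sub _ (T.m_pos _).le]
  refine ENNReal.ofReal_le_ofReal ?_
  have h1 := hT.m_iterate_pred hq 1 (T.pred^[p.2] x)
  rw [Function.iterate_one, ← Function.iterate_succ_apply' T.pred, pow_one] at h1
  have h2 : (2 : ℝ) ≤ q := by exact_mod_cast hq
  have h3 := T.m_pos (T.pred^[p.2] x)
  rw [Nat.succ_eq_add_one] at h1
  nlinarith

/-- The `L¹` norm of the image under a spectral multiplier of a difference of point masses. -/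
theorem le_eLpNorm_multiplier_sub {T : FlowTree V} {q : ℕ} (hT : T.IsCanonical q) (hq : 2 ≤ q)
    {F : ℝ → ℂ} (hF : Continuous F) (x : V) (N : ℕ) :
    ENNReal.ofReal (1 / 4) * (N * ∑' n : ℕ, ‖sineDiff F ((n + (N + 2) : ℕ) : ℤ)‖ₑ) ≤
      eLpNorm (T.multiplier F (T.pointMass x - T.pointMass (T.pred x))) 1 T.measure := by
  obtain ⟨M, hM⟩ := exists_norm_sineCoeff_le hF
  have hM1 : ∀ n, ‖sineCoeff F (n + 1)‖ ≤ M := fun n => hM _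
  have hMd : ∀ n, ‖sineDiff F n‖ ≤ M + M := fun n =>
    (norm_sub_le _ _).trans (add_le_add (hM _) (hM _))
  set g := T.multiplier F (T.pointMass x - T.pointMass (T.pred x)) with hg
  have hval : ∀ p : ℕ × ℕ, ∀ y ∈ T.meetingSet x p,
      g y = (T.m (T.pred^[p.2 + 1] x) : ℂ)⁻¹ * geomSum q (sineDiff F) (p.1 + p.2 + 2) := by
    rintro ⟨a, b⟩ y ⟨h1, h2⟩
    have hm := T.meetsAt_succ h1 h2
    -- Meeting `x` after `b + 1 ≥ 1` steps means meeting `p(x)` after `b` steps at the same vertex: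
    -- the weights agree and the indices `a + b + 3` and `a + b + 2` produce a `sineDiff`.
    rw [← T.inner_pointMass, hg, map_sub, inner_sub_right, inner_multiplier_pointMass hT hq hF hm,
      inner_multiplier_pointMass hT hq hF hm.pred, ← Function.iterate_succ_apply, ← mul_sub]
    congr 1
    have : sineDiff F = fun n => sineCoeff F (n + 1) - sineCoeff F n := rfl
    rw [this, geomSum_sub hq hM1 hM]
    congr 1
    · unfold geomSum
      refine tsum_congr fun l => ?_
      congr 2
      push_cast
      ring
    · congr 1
      dsimp only
      ring
  rw [eLpNorm_one_eq_lintegral_enorm]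
  calc ENNReal.ofReal (1 / 4) * (N * ∑' n : ℕ, ‖sineDiff F ((n + (N + 2) : ℕ) : ℤ)‖ₑ)
      ≤ ENNReal.ofReal (1 / 4) * (N * (2 * ∑' n : ℕ, ‖geomSum q (sineDiff F) (n + (N + 2))‖ₑ)) := by
        gcongr
        exact tsum_enorm_le_tsum_geomSum hq hMd (N + 2)
    _ = ENNReal.ofReal (1 / 2) * (N * ∑' n : ℕ, ‖geomSum q (sineDiff F) (n + (N + 2))‖ₑ) := by
        rw [mul_left_comm (N : ℝ≥0∞), ← mul_assoc]
        congr 1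
        rw [show (2 : ℝ≥0∞) = ENNReal.ofReal 2 by simp, ← ENNReal.ofReal_mul (by norm_num)]
        norm_num
    _ ≤ ENNReal.ofReal (1 / 2) * ∑' p : ℕ × ℕ, ‖geomSum q (sineDiff F) (p.1 + p.2 + 2)‖ₑ := by
        gcongr
        exact nsmul_tsum_le_tsum_prod (fun n => ‖geomSum q (sineDiff F) n‖ₑ) N
    _ = ∑' p : ℕ × ℕ, ENNReal.ofReal (1 / 2) * ‖geomSum q (sineDiff F) (p.1 + p.2 + 2)‖ₑ :=
        ENNReal.tsum_mul_left.symm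
    _ ≤ ∑' p : ℕ × ℕ, ∫⁻ y in T.meetingSet x p, ‖g y‖ₑ ∂T.measure := by
        refine ENNReal.tsum_le_tsum fun p => ?_
        have hm := T.m_pos (T.pred^[p.2 + 1] x)
        rw [setLIntegral_congr_fun MeasurableSet.of_discrete
          (fun y hy => congrArg enorm (hval p y hy)), setLIntegral_const]
        rw [enorm_mul, ← ofReal_norm ((T.m (T.pred^[p.2 + 1] x) : ℂ)⁻¹), norm_inv,
          Complex.norm_real, Real.norm_of_nonneg hm.le, mul_right_comm]
        refine mul_le_mul' ?_ le_rfl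
        -- The weight `m⁻¹` of the kernel cancels the mass of the meeting set up to `1 / 2`; with
        -- the factor 2 lost in inverting the geometric sum, this gives `1 / 4`.
        calc ENNReal.ofReal (1 / 2)
            = ENNReal.ofReal (T.m (T.pred^[p.2 + 1] x))⁻¹ *
                ENNReal.ofReal (T.m (T.pred^[p.2 + 1] x) / 2) := by
              rw [← ENNReal.ofReal_mul (by positivity)]
              congr 1
              field_simp
          _ ≤ _ := by
              gcongr
              exact le_measure_meetingSet hT hq x p
    _ = ∫⁻ y in ⋃ p, T.meetingSet x p, ‖g y‖ₑ ∂T.measure :=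
        (lintegral_iUnion (fun p => MeasurableSet.of_discrete) (T.meetingSet_disjoint x) _).symm
    _ ≤ _ := setLIntegral_le_lintegral _ _

theorem IsAtom.eLpNorm_le_one {T : FlowTree V} {a : V → ℂ} (ha : T.IsAtom a) :
    eLpNorm a 1 T.measure ≤ 1 := by
  obtain ⟨x, h', h'', -, -, -, hs, hb, -⟩ := ha
  set R := T.trapezoid x h' h''
  rw [eLpNorm_one_eq_lintegral_enorm]
  calc _ ≤ ∫⁻ y, R.indicator (fun _ => (T.measure R)⁻¹) y ∂T.measure := by
        refine lintegral_mono fun y => ?_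
        by_cases hy : y ∈ R
        · rw [Set.indicator_of_mem hy]
          exact hb y
        · have : a y = 0 := by
            by_contra h
            exact hy (hs h)
          simp [this]
    _ = (T.measure R)⁻¹ * T.measure R := by
        rw [lintegral_indicator MeasurableSet.of_discrete, setLIntegral_const]
    _ ≤ 1 := ENNReal.inv_mul_le_one _

theorem integral_pointMass (x : V) : ∫ y, T.pointMass x y ∂T.measure = 1 := by
  rw [T.coe_pointMass, integral_indicator MeasurableSet.of_discrete, setIntegral_const,
    T.measureReal_singleton]
  have hm : (T.m x : ℂ) ≠ 0 := by exact_mod_cast (T.m_pos x).ne'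
  rw [Complex.real_smul, mul_inv_cancel₀ hm]

theorem integrable_pointMass (x : V) : Integrable (T.pointMass x) T.measure := by
  rw [T.coe_pointMass, integrable_indicator_iff MeasurableSet.of_discrete]
  exact integrableOn_const (T.measure_singleton_ne_top x) (by simp)

/-- The normalized difference of the point masses at a vertex and at its predecessor. -/
def pointDiff (q : ℕ) (x : V) : Lp ℂ 2 T.measure :=
  ((2 * q ^ 2 : ℝ)⁻¹ : ℂ) • (T.pointMass x - T.pointMass (T.pred x))

theorem coe_pointDiff (q : ℕ) (x : V) :
    (T.pointDiff q x : V → ℂ) = fun y => ((2 * q ^ 2 : ℝ)⁻¹ : ℂ) *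
      (T.pointMass x y - T.pointMass (T.pred x) y) := by
  apply T.eq_of_ae_eq
  unfold pointDiff
  filter_upwards [Lp.coeFn_smul ((2 * q ^ 2 : ℝ)⁻¹ : ℂ)
    (T.pointMass x - T.pointMass (T.pred x)), Lp.coeFn_sub (T.pointMass x)
      (T.pointMass (T.pred x))] with y h1 h2
  rw [h1, Pi.smul_apply, h2, Pi.sub_apply, smul_eq_mul]

/-- The trapezoid consists of the first two generations below `p²(x)`, each of mass `q² m(x)`; this
fixes the normalization of `pointDiff`. -/
theorem measure_trapezoid_le {T : FlowTree V} {q : ℕ} (hT : T.IsCanonical q) (hq : 2 ≤ q) (x : V) :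
    T.measure (T.trapezoid (T.pred^[2] x) 1 3) ≤ ENNReal.ofReal (2 * q ^ 2 * T.m x) := by
  have hsub : T.trapezoid (T.pred^[2] x) 1 3 ⊆
      T.pred^[1] ⁻¹' {T.pred^[2] x} ∪ T.pred^[2] ⁻¹' {T.pred^[2] x} := by
    rintro y ⟨h1, h2, h3⟩
    have h := T.iterate_pred_of_below h1
    rw [SimpleGraph.dist_comm] at h2 h3
    have hd : T.graph.dist y (T.pred^[2] x) = 1 ∨ T.graph.dist y (T.pred^[2] x) = 2 := by omega
    rcases hd with hd | hd
    · left; rw [hd] at h; exact h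
    · right; rw [hd] at h; exact h
  refine (measure_mono hsub).trans ((measure_union_le _ _).trans ?_)
  rw [T.measure_preimage_iterate_pred, T.measure_preimage_iterate_pred, hT.m_iterate_pred hq]
  have := T.m_pos x
  rw [← ENNReal.ofReal_add (by positivity) (by positivity)]
  refine ENNReal.ofReal_le_ofReal (le_of_eq ?_)
  ring

theorem isAtom_pointDiff {T : FlowTree V} {q : ℕ} (hT : T.IsCanonical q) (hq : 2 ≤ q) (x : V) :
    T.IsAtom (T.pointDiff q x) := by
  classical
  have hq2 : (2 : ℝ) ≤ q := by exact_mod_cast hq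
  have hm := T.m_pos x
  have hne : T.pred x ≠ x := by
    intro h
    have := (T.pred_spec x).2
    rw [h] at this
    omega
  -- With apex `p²(x)` and heights 1 and 2, the smallest heights allowed, the trapezoid contains
  -- both `p(x)` and `x`.
  refine ⟨T.pred^[2] x, 1, 3, le_rfl, by norm_num, by norm_num, ?_, ?_, ?_⟩
  · intro y hy
    have hy' : y = x ∨ y = T.pred x := by
      by_contra! hcon
      apply hy
      rw [T.coe_pointDiff]
      dsimp only
      rw [T.pointMass_apply, T.pointMass_apply, if_neg hcon.1, if_neg hcon.2, sub_zero, mul_zero]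
    rcases hy' with rfl | rfl
    · have h1 := T.dist_iterate_pred 2 y
      refine ⟨T.below_iterate_pred 2 y, ?_, ?_⟩ <;> rw [SimpleGraph.dist_comm] <;> omega
    · have h1 := T.dist_iterate_pred 1 (T.pred x)
      refine ⟨T.below_iterate_pred 1 (T.pred x), ?_, ?_⟩ <;> rw [SimpleGraph.dist_comm]
      · exact h1.ge
      · have : T.graph.dist (T.pred x) (T.pred^[2] x) = 1 := h1
        omega
  · intro y
    have hbound : ‖T.pointDiff q x y‖ ≤ (2 * q ^ 2 * T.m x)⁻¹ := by
      have h1 : ‖T.pointMass x y - T.pointMass (T.pred x) y‖ ≤ (T.m x)⁻¹ := by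
        rw [T.pointMass_apply, T.pointMass_apply]
        by_cases h1 : y = x
        · subst h1
          rw [if_pos rfl, if_neg hne.symm, sub_zero, norm_inv, Complex.norm_real,
            Real.norm_of_nonneg hm.le]
        · rw [if_neg h1, zero_sub, norm_neg]
          split_ifs
          · rw [norm_inv, Complex.norm_real, Real.norm_of_nonneg (T.m_pos _).le]
            have h3 := hT.m_iterate_pred hq 1 x
            rw [Function.iterate_one, pow_one] at h3
            rw [h3]
            gcongr
            nlinarith
          · simpa using hm.le
      rw [T.coe_pointDiff, norm_mul, mul_inv]
      gcongr
      rw [← Complex.ofReal_inv, Complex.norm_real, Real.norm_of_nonneg (by positivity)]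
    rw [ENNReal.le_inv_iff_le_inv]
    refine (measure_trapezoid_le hT hq x).trans ?_
    rw [← ofReal_norm, ENNReal.le_inv_iff_le_inv]
    refine (ENNReal.ofReal_le_ofReal hbound).trans (le_of_eq ?_)
    exact ENNReal.ofReal_inv_of_pos (by positivity)
  · rw [T.coe_pointDiff, integral_const_mul, integral_sub (T.integrable_pointMass _)
      (T.integrable_pointMass _), T.integral_pointMass, T.integral_pointMass, sub_self, mul_zero]

theorem eLpNorm_multiplier_pointDiff (F : ℝ → ℂ) (q : ℕ) (x : V) :
    eLpNorm (T.multiplier F (T.pointDiff q x)) 1 T.measure =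
      ENNReal.ofReal (2 * q ^ 2 : ℝ)⁻¹ *
        eLpNorm (T.multiplier F (T.pointMass x - T.pointMass (T.pred x))) 1 T.measure := by
  unfold pointDiff
  rw [map_smul, eLpNorm_congr_ae (Lp.coeFn_smul _ _), eLpNorm_const_smul, ← ofReal_norm,
    ← Complex.ofReal_inv, Complex.norm_real, Real.norm_of_nonneg (by positivity)]

/-- There are atoms whose images under the truncated Schrödinger propagators have an `L¹` norm
growing like `t^{3/2}`. -/
theorem exists_le_eLpNorm_schrodinger {χ₀ : ℝ → ℂ} (hsmooth : ContDiff ℝ ∞ χ₀)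
    (hsupp : tsupport χ₀ ⊆ Set.Ioo (-1 / 2) (1 / 2))
    (hone : ∀ x ∈ Set.Icc (-1 / 4 : ℝ) (1 / 4), χ₀ x = 1) :
    ∃ t₀ : ℝ, 1 ≤ t₀ ∧ ∀ q : ℕ, 2 ≤ q → ∃ c : ℝ, 0 < c ∧
      ∀ (V : Type*) [MeasurableSpace V] [DiscreteMeasurableSpace V] (T : FlowTree V),
        T.IsCanonical q → ∃ f : Lp ℂ 2 T.measure, T.IsAtom f ∧ ∀ t : ℝ, t₀ ≤ t →
          ENNReal.ofReal (c * t ^ (3 / 2 : ℝ)) ≤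
            eLpNorm (T.multiplier (schrodinger χ₀ t) f) 1 T.measure := by
  obtain ⟨t₀, c, δ, ht₀, hc, hδ, h⟩ := exists_le_tsum_sineDiff_schrodinger hsmooth hsupp hone
  -- The constant collects the normalization `(2q²)⁻¹` of the atom, the `1 / 4` of the kernel
  -- estimate, `N ≥ δt` and the tail bound `c√t`. The atom does not depend on `t`, and any vertex
  -- would do as its base.
  refine ⟨t₀, ht₀, fun q hq => ⟨(2 * q ^ 2 : ℝ)⁻¹ * (1 / 4 * (δ * c)), by positivity,
    fun V _ _ T hT => ⟨T.pointDiff q (T.ray 0), isAtom_pointDiff hT hq _, fun t ht => ?_⟩⟩⟩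
  obtain ⟨N, hN, hN'⟩ := h t ht
  have ht0 : 0 < t := by linarith
  have hpow : t ^ (3 / 2 : ℝ) = t * √t := by
    rw [Real.sqrt_eq_rpow, ← Real.rpow_one_add' ht0.le (by norm_num)]
    norm_num
  rw [T.eLpNorm_multiplier_pointDiff]
  have heq : (2 * q ^ 2 : ℝ)⁻¹ * (1 / 4 * (δ * c)) * t ^ (3 / 2 : ℝ) =
      (2 * q ^ 2 : ℝ)⁻¹ * (1 / 4 * ((δ * t) * (c * √t))) := by rw [hpow]; ring
  rw [heq, ENNReal.ofReal_mul (by positivity), ENNReal.ofReal_mul (by positivity),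
    ENNReal.ofReal_mul (by positivity)]
  gcongr
  refine le_trans ?_ (le_eLpNorm_multiplier_sub hT hq
    (continuous_schrodinger hsmooth.continuous t) (T.ray 0) N)
  gcongr
  rw [← ENNReal.ofReal_natCast]
  exact ENNReal.ofReal_le_ofReal hN

end FlowTree

/-! ### Comparison of growth rates and conclusion -/

theorem exists_lt_rpow_of_lt {s : ℝ} (hs0 : 0 ≤ s) (hs : s < 3 / 2) {c : ℝ} (hc : 0 < c)
    (K t₀ : ℝ) : ∃ t : ℝ, 1 ≤ t ∧ t₀ ≤ t ∧ K * (1 + 2 * |t|) ^ s < c * t ^ (3 / 2 : ℝ) := by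
  have htend := tendsto_rpow_atTop (y := 3 / 2 - s) (by linarith)
  obtain ⟨t, h1, h2, h3⟩ := ((eventually_ge_atTop (1 : ℝ)).and ((eventually_ge_atTop t₀).and
    (htend.eventually_gt_atTop (|K| * 3 ^ s / c)))).exists
  refine ⟨t, h1, h2, ?_⟩
  have ht0 : 0 < t := by linarith
  rw [div_lt_iff₀ hc] at h3
  calc K * (1 + 2 * |t|) ^ s ≤ |K| * (3 * t) ^ s := by
        rw [abs_of_pos ht0]
        gcongr
        · exact le_abs_self K
        · linarith
    _ = |K| * 3 ^ s * t ^ s := by rw [Real.mul_rpow (by norm_num) ht0.le]; ring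
    _ < t ^ (3 / 2 - s) * c * t ^ s := by gcongr
    _ = c * (t ^ (3 / 2 - s) * t ^ s) := by ring
    _ = c * t ^ (3 / 2 : ℝ) := by rw [← Real.rpow_add ht0]; congr 2; ring

/-- A polynomial bound of order `s < 3 / 2` contradicts growth of order `3 / 2`. -/
theorem not_forall_rpow_le {s : ℝ} (hs0 : 0 ≤ s) (hs : s < 3 / 2) {c : ℝ} (hc : 0 < c)
    (C : ℝ≥0) (K t₀ : ℝ) (h : ∀ t : ℝ, t₀ ≤ t → ENNReal.ofReal (c * t ^ (3 / 2 : ℝ)) ≤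
      C * ENNReal.ofReal (K * (1 + 2 * |t|) ^ s)) : False := by
  obtain ⟨t, ht1, ht, hlt⟩ := exists_lt_rpow_of_lt hs0 hs hc (C * |K|) t₀
  have h1 : ENNReal.ofReal (c * t ^ (3 / 2 : ℝ)) ≤
      ENNReal.ofReal (C * |K| * (1 + 2 * |t|) ^ s) := by
    refine (h t ht).trans ?_
    rw [← ENNReal.ofReal_coe_nnreal, ← ENNReal.ofReal_mul (NNReal.coe_nonneg C)]
    refine ENNReal.ofReal_le_ofReal ?_
    rw [mul_assoc]
    gcongr
    exact le_abs_self K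
  have hK : 0 ≤ (C : ℝ) * |K| * (1 + 2 * |t|) ^ s := by positivity
  rw [ENNReal.ofReal_le_ofReal_iff hK] at h1
  exact absurd h1 (not_le.2 hlt)

namespace FlowTree

variable {V : Type*} [MeasurableSpace V] {T : FlowTree V}

theorem IsAtom.le_hardyOpNorm {f : Lp ℂ 2 T.measure} (hf : T.IsAtom f)
    (A : Lp ℂ 2 T.measure →L[ℂ] Lp ℂ 2 T.measure) :
    eLpNorm (A f) 1 T.measure ≤ T.hardyOpNorm A :=
  le_iSup₂_of_le f hf.hardyNorm_le_one le_rfl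

theorem IsAtom.le_lOneOpNorm [DiscreteMeasurableSpace V] {f : Lp ℂ 2 T.measure} (hf : T.IsAtom f)
    (A : Lp ℂ 2 T.measure →L[ℂ] Lp ℂ 2 T.measure) :
    eLpNorm (A f) 1 T.measure ≤ T.lOneOpNorm A :=
  le_iSup₂_of_le f hf.eLpNorm_le_one le_rfl

end FlowTree

theorem hasCompactSupport_schrodinger {χ₀ : ℝ → ℂ} (h : HasCompactSupport χ₀) (t : ℝ) :
    HasCompactSupport (schrodinger χ₀ t) :=
  h.mul_left

end

theorem proposition6p11 (χ₀ : ℝ → ℂ) (hsmooth : ContDiff ℝ ∞ χ₀) (hcompact : HasCompactSupport χ₀)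
    (hsupp : tsupport χ₀ ⊆ Set.Ioo (-1 / 2) (1 / 2))
    (hone : ∀ x ∈ Set.Icc (-1 / 4 : ℝ) (1 / 4), χ₀ x = 1) :
    -- upper bound for the Sobolev norms
    (∀ s : ℝ, 0 ≤ s → ∃ C : ℝ, 0 < C ∧ ∀ t : ℝ,
      sobolevNorm ⊤ s (schrodinger χ₀ t) ≤ ENNReal.ofReal (C * (1 + |t|) ^ s)) ∧
    -- lower bound for the operator norms
    (∃ t₀ : ℝ, 0 < t₀ ∧ ∀ q : ℕ, 2 ≤ q → ∃ c : ℝ, 0 < c ∧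
      ∀ (V : Type*) [MeasurableSpace V] [DiscreteMeasurableSpace V] (T : FlowTree V),
        T.IsCanonical q → ∀ t : ℝ, t₀ ≤ t →
          ENNReal.ofReal (c * t ^ (3 / 2 : ℝ)) ≤
            T.hardyOpNorm (T.multiplier (schrodinger χ₀ t))) ∧
    -- below order `3 / 2` the multiplier estimates fail, already for test functions
    (∀ q : ℕ, 2 ≤ q → ∀ s : ℝ, 0 ≤ s → s < 3 / 2 →
      ∀ (V : Type*) [MeasurableSpace V] [DiscreteMeasurableSpace V] (T : FlowTree V),
        T.IsCanonical q →
          (¬ ∃ C : ℝ≥0, ∀ F : ℝ → ℂ, ContDiff ℝ ∞ F → HasCompactSupport F →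
            T.lOneOpNorm (T.multiplier F) ≤ C * sobolevNorm 2 s F) ∧
          (∀ χ : ℝ → ℝ, ContDiff ℝ ∞ χ → HasCompactSupport χ →
            tsupport χ ⊆ Set.Ioo (3 / 4) (5 / 4) → (∀ x, 0 ≤ χ x ∧ χ x ≤ 1) → χ 1 = 1 →
            ¬ ∃ C : ℝ≥0, ∀ F : ℝ → ℂ, ContDiff ℝ ∞ F → HasCompactSupport F →
              T.hardyOpNorm (T.multiplier F) ≤
                C * ⨆ r ∈ Set.Ioc (0 : ℝ) 2, sobolevNorm 2 s (fun x => F (r * x) * (χ x : ℂ)))) := by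
  refine ⟨fun s hs => ?_, ?_, fun q hq s hs0 hs V _ _ T hT => ⟨?_, ?_⟩⟩
  · obtain ⟨C, hC, h⟩ := exists_sobolevNorm_schrodinger_le hsmooth hcompact hsupp hs
    exact ⟨C, hC, fun t => (h t).1⟩
  · obtain ⟨t₀, ht₀, h⟩ := FlowTree.exists_le_eLpNorm_schrodinger hsmooth hsupp hone
    refine ⟨t₀, by linarith, fun q hq => ?_⟩
    obtain ⟨c, hc, hV⟩ := h q hq
    refine ⟨c, hc, fun V _ _ T hT t ht => ?_⟩
    obtain ⟨f, hf, hft⟩ := hV V T hT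
    exact (hft t ht).trans (hf.le_hardyOpNorm _)
  -- The functions `F_t` are themselves admissible test functions, and the same atom also has `L¹`
  -- norm at most one.
  · rintro ⟨C, hC⟩
    obtain ⟨t₀, ht₀, h⟩ := FlowTree.exists_le_eLpNorm_schrodinger hsmooth hsupp hone
    obtain ⟨c, hc, hV⟩ := h q hq
    obtain ⟨f, hf, hft⟩ := hV V T hT
    obtain ⟨K, hK, hs2⟩ := exists_sobolevNorm_schrodinger_le hsmooth hcompact hsupp hs0
    refine not_forall_rpow_le hs0 hs hc C K t₀ fun t ht => ?_
    refine (hft t ht).trans ((hf.le_lOneOpNorm _).trans ((hC _ (contDiff_schrodinger hsmooth t)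
      (hasCompactSupport_schrodinger hcompact t)).trans ?_))
    gcongr
    refine (hs2 t).2.trans (ENNReal.ofReal_le_ofReal ?_)
    gcongr
    linarith [abs_nonneg t]
  · rintro χ hχ hχc hχs - - ⟨C, hC⟩
    obtain ⟨t₀, ht₀, h⟩ := FlowTree.exists_le_eLpNorm_schrodinger hsmooth hsupp hone
    obtain ⟨c, hc, hV⟩ := h q hq
    obtain ⟨f, hf, hft⟩ := hV V T hT
    obtain ⟨K, hK, hs2⟩ :=
      exists_sobolevNorm_schrodinger_localized_le hsmooth hcompact hχ hχc hχs hs0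
    refine not_forall_rpow_le hs0 hs hc C K t₀ fun t ht => ?_
    refine (hft t ht).trans ((hf.le_hardyOpNorm _).trans ((hC _ (contDiff_schrodinger hsmooth t)
      (hasCompactSupport_schrodinger hcompact t)).trans ?_))
    gcongr
    -- The localized bound is uniform over `0 < r ≤ 2`, so it passes to the supremum.
    exact iSup₂_le fun r hr => hs2 t r hr
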